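/- A \emph{bunch of grapes} $\Gamma=(T,\ell)$ is given by a finite tree $T$ (the \emph{stem}) and a function $\ell:V(T)\to\mathbb Z_{\ge 0}$; it is the simple graph obtained from $T$ by attaching $\ell(v)$ copies of a $3$-cycle to each vertex $v$ of $T$. Assume that $\Gamma$ is a minimal simplicial model, i.e. $\ell(v)\ge 1$ for every vertex $v$ of valency $2$ in $T$, and that $\Gamma$ is \emph{normal}, i.e. $\ell(v)>0$ for at least two distinct vertices $v$ of $T$ and $\ell(v)\ge1$ for every leaf $v$ of $T$. Let $UD_2(\Gamma)$ be the unordered discrete $2$-configuration space of $\Gamma$, the square complex whose cells are the unordered pairs $\{\sigma,\tau\}$ of disjoint closed cells (vertices or edges) of $\Gamma$. For a square complex $Y$, a \emph{standard product structure} is a local isometry $\iota:\Delta_1\times\Delta_2\to Y$, where $\Delta_1,\Delta_2$ are connected graphs with at least one edge and no vertex of valency one, such that $\iota$ restricts to an isomorphism onto its image on $\Delta_1\times\{w_2\}$ and on $\{w_1\}\times\Delta_2$ for some vertices $w_i\in\Delta_i$. Here a local isometry is a combinatorial map that is injective on the link of each vertex, with image an induced subcomplex of the link of the image vertex. A \emph{standard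 product subcomplex} of $Y$ is the image of a standard product structure, and a \emph{maximal product subcomplex} is a standard product subcomplex that is maximal with respect to inclusion. Let $UP_2(\Gamma)\subset UD_2(\Gamma)$ be the union of all maximal product subcomplexes of $UD_2(\Gamma)$. The \emph{intersection complex} $\mathcal I(Y)$ is the complex of simplices whose vertices are the maximal product subcomplexes of $Y$, in which $M_0,\dots,M_n$ (pairwise distinct) span one $n$-simplex for each $K$ that is maximal among the standard product subcomplexes contained in $M_0\cap\dots\cap M_n$; the simplex of $(\{M_i\}_{i\in I},K)$ is a face of that of $(\{M_j\}_{j\in J},K')$ if $\{M_i\}_{i\in I}\subset\{M_j\}_{j\in J}$ and $K\supset K'$. Then the following are equivalent: \begin{enumerate} \item the stem $T$ is a path graph; \item the intersection complex $\mathcal I(UP_2(\Gamma))$ is a simplex; \item the intersection complex $\mathcal I(UP_2(\Gamma))$ is simply connected. \end{enumerate} -/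

import Mathlib

universe u v

/-! ### Square complexes -/

/-- A square complex all of whose (closed) cells are embedded cubes of dimension at most two that
are determined by their vertices.  A cell is recorded by its set of vertices, and the face relation
is inclusion.  The vertices of the complex are those `x : V` for which `{x}` is a cell. -/
structure SquareComplex (V : Type u) where
  cells : Set (Set V)
  singleton_mem : ∀ c ∈ cells, ∀ x ∈ c, {x} ∈ cells
  shape : ∀ c ∈ cells,
    (∃ x, c = {x}) ∨
    (∃ x y, x ≠ y ∧ c = {x, y}) ∨
    (∃ x y z w, [x, y, z, w].Nodup ∧ c = {x, y, z, w} ∧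
      {x, y} ∈ cells ∧ {y, z} ∈ cells ∧ {z, w} ∈ cells ∧ {w, x} ∈ cells ∧
      {x, z} ∉ cells ∧ {y, w} ∉ cells)

/-- The cells of a simple graph seen as a one-dimensional complex: vertices and edges. -/
def SimpleGraph.cells {V : Type u} (G : SimpleGraph V) : Set (Set V) :=
  {s | (∃ v, s = {v}) ∨ ∃ v w, G.Adj v w ∧ s = {v, w}}

/-- A graph is leafless if it has no vertex of valency one. -/
def SimpleGraph.IsLeafless {V : Type u} (G : SimpleGraph V) : Prop :=
  ∀ v, (G.neighborSet v).ncard ≠ 1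

/-- The product of two graphs, as a square complex. -/
def SquareComplex.prod {A : Type u} {B : Type v} (G : SimpleGraph A) (H : SimpleGraph B) :
    SquareComplex (A × B) where
  cells := {c | ∃ s ∈ G.cells, ∃ t ∈ H.cells, c = s ×ˢ t}
  singleton_mem := by
    rintro c ⟨s, -, t, -, rfl⟩ ⟨a, b⟩ -
    exact ⟨{a}, Or.inl ⟨a, rfl⟩, {b}, Or.inl ⟨b, rfl⟩, by simp⟩
  shape := by
    rintro c ⟨s, (⟨a, rfl⟩ | ⟨a, a', ha, rfl⟩), t, (⟨b, rfl⟩ | ⟨b, b', hb, rfl⟩), rfl⟩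
    · exact Or.inl ⟨(a, b), by simp⟩
    · refine Or.inr (Or.inl ⟨(a, b), (a, b'), by simp [hb.ne], ?_⟩)
      ext ⟨x, y⟩; simp; tauto
    · refine Or.inr (Or.inl ⟨(a, b), (a', b), by simp [ha.ne], ?_⟩)
      ext ⟨x, y⟩; simp; tauto
    · have key : ∀ x x' y y', x ≠ x' → y ≠ y' →
          ({(x, y), (x', y')} : Set (A × B)) ∉
            {c | ∃ s ∈ G.cells, ∃ t ∈ H.cells, c = s ×ˢ t} := by
        rintro x x' y y' hx hy ⟨s, -, t, -, h⟩
        have h1 : (x, y) ∈ s ×ˢ t := h ▸ (by simp)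
        have h2 : (x', y') ∈ s ×ˢ t := h ▸ (by simp)
        have h3 : (x, y') ∈ ({(x, y), (x', y')} : Set (A × B)) := h ▸ ⟨h1.1, h2.2⟩
        simp [hx, hy.symm] at h3
      refine Or.inr (Or.inr ⟨(a, b), (a, b'), (a', b'), (a', b),
        by simp [ha.ne, hb.ne, hb.ne'], ?_, ?_, ?_, ?_, ?_, key _ _ _ _ ha.ne hb.ne,
        key _ _ _ _ ha.ne hb.ne'⟩)
      · ext ⟨x, y⟩; simp; tauto
      · exact ⟨{a}, Or.inl ⟨a, rfl⟩, {b, b'}, Or.inr ⟨b, b', hb, rfl⟩,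
          by ext ⟨x, y⟩; simp; tauto⟩
      · exact ⟨{a, a'}, Or.inr ⟨a, a', ha, rfl⟩, {b'}, Or.inl ⟨b', rfl⟩,
          by ext ⟨x, y⟩; simp; tauto⟩
      · exact ⟨{a'}, Or.inl ⟨a', rfl⟩, {b, b'}, Or.inr ⟨b, b', hb, rfl⟩,
          by ext ⟨x, y⟩; simp; tauto⟩
      · exact ⟨{a, a'}, Or.inr ⟨a, a', ha, rfl⟩, {b}, Or.inl ⟨b, rfl⟩,
          by ext ⟨x, y⟩; simp; tauto⟩

/-- The cells of the unordered discrete 2-configuration space: the cell `{σ, τ}` given by two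
disjoint (closed) cells `σ`, `τ` of the graph has as vertices the pairs `{x, y}`, `x ∈ σ`,
`y ∈ τ`. -/
def SimpleGraph.configCells {V : Type u} (G : SimpleGraph V) : Set (Set (Sym2 V)) :=
  {c | ∃ σ ∈ G.cells, ∃ τ ∈ G.cells, Disjoint σ τ ∧ c = Set.image2 (fun x y => s(x, y)) σ τ}

theorem SimpleGraph.pair_mem_configCells {V : Type u} (G : SimpleGraph V) {x y z : V}
    (h : G.Adj y z) (hy : x ≠ y) (hz : x ≠ z) : {s(x, y), s(x, z)} ∈ G.configCells :=
  ⟨{x}, Or.inl ⟨x, rfl⟩, {y, z}, Or.inr ⟨y, z, h, rfl⟩, by simp [hy, hz],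
    by rw [Set.image2_singleton_left, Set.image_pair]⟩

theorem SimpleGraph.pair_notMem_configCells {V : Type u} (G : SimpleGraph V) {x x' y y' : V}
    (hx : x ≠ x') (hy : y ≠ y') (h1 : x ≠ y) (h2 : x ≠ y') (h3 : x' ≠ y) (_h4 : x' ≠ y') :
    {s(x, y), s(x', y')} ∉ G.configCells := by
  rintro ⟨s, -, t, -, hd, h⟩
  have m1 : s(x, y) ∈ Set.image2 (fun x y => s(x, y)) s t := h ▸ (by simp)
  have m2 : s(x', y') ∈ Set.image2 (fun x y => s(x, y)) s t := h ▸ (by simp)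
  obtain ⟨p, hp, q, hq, e1⟩ := m1
  obtain ⟨p', hp', q', hq', e2⟩ := m2
  have m3 : s(p, q') ∈ ({s(x, y), s(x', y')} : Set (Sym2 V)) := h ▸ ⟨p, hp, q', hq', rfl⟩
  simp only [Sym2.eq_iff, Set.mem_insert_iff, Set.mem_singleton_iff] at e1 e2 m3
  grind

/-- The unordered discrete 2-configuration space `UD₂(G)` of a simple graph. -/
def SimpleGraph.UD2 {V : Type u} (G : SimpleGraph V) : SquareComplex (Sym2 V) where
  cells := G.configCells
  singleton_mem := by
    rintro c ⟨σ, -, τ, -, hd, rfl⟩ _ ⟨x, hx, y, hy, rfl⟩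
    have hxy : x ≠ y := fun h => Set.disjoint_left.1 hd hx (h ▸ hy)
    exact ⟨{x}, Or.inl ⟨x, rfl⟩, {y}, Or.inl ⟨y, rfl⟩, by simpa using hxy, by simp⟩
  shape := by
    rintro c ⟨s, (⟨a, rfl⟩ | ⟨a, a', ha, rfl⟩), t, (⟨b, rfl⟩ | ⟨b, b', hb, rfl⟩), hd, rfl⟩
    · exact Or.inl ⟨s(a, b), by simp⟩
    · refine Or.inr (Or.inl ⟨s(a, b), s(a, b'), ?_, ?_⟩)
      · rw [Ne, Sym2.congr_right]; exact hb.ne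
      · rw [Set.image2_singleton_left, Set.image_pair]
    · refine Or.inr (Or.inl ⟨s(a, b), s(a', b), ?_, ?_⟩)
      · rw [Ne, Sym2.congr_left]; exact ha.ne
      · rw [Set.image2_singleton_right, Set.image_pair]
    · have hab : a ≠ b := fun h => Set.disjoint_left.1 hd (by simp : a ∈ _) (by simp [h])
      have hab' : a ≠ b' := fun h => Set.disjoint_left.1 hd (by simp : a ∈ _) (by simp [h])
      have ha'b : a' ≠ b := fun h => Set.disjoint_left.1 hd (by simp : a' ∈ _) (by simp [h])
      have ha'b' : a' ≠ b' := fun h => Set.disjoint_left.1 hd (by simp : a' ∈ _) (by simp [h])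
      have haa := ha.ne
      have hbb := hb.ne
      refine Or.inr (Or.inr ⟨s(a, b), s(a, b'), s(a', b'), s(a', b), ?_, ?_,
        G.pair_mem_configCells hb hab hab', ?_, G.pair_mem_configCells hb.symm ha'b' ha'b, ?_,
        G.pair_notMem_configCells haa hbb hab hab' ha'b ha'b',
        G.pair_notMem_configCells haa hbb.symm hab' hab ha'b' ha'b⟩)
      · simp only [List.nodup_cons, List.mem_cons, List.not_mem_nil, Sym2.eq_iff, or_false,
          not_or, not_and, List.nodup_nil, and_true, not_false_eq_true]
        grind
      · rw [Set.image2_insert_left, Set.image_pair, Set.image2_singleton_left, Set.image_pair]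
        ext z
        simp only [Set.mem_union, Set.mem_insert_iff, Set.mem_singleton_iff]
        tauto
      · rw [Sym2.eq_swap, Sym2.eq_swap (a := a')]
        exact G.pair_mem_configCells ha hab'.symm ha'b'.symm
      · rw [Sym2.eq_swap, Sym2.eq_swap (a := a)]
        exact G.pair_mem_configCells ha.symm ha'b.symm hab.symm

namespace SquareComplex

/-! ### Local isometries and product subcomplexes -/

/-- A combinatorial map: it sends every cell bijectively onto a cell. -/
def IsCombinatorial {V : Type u} {W : Type v} (X : SquareComplex V) (Y : SquareComplex W)
    (f : V → W) : Prop :=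
  ∀ c ∈ X.cells, f '' c ∈ Y.cells ∧ Set.InjOn f c

/-- A local isometry: a combinatorial map that is injective on the link of every vertex `x`, with
image an induced subcomplex of the link of `f x`.  The simplices of the link of `x` are the cells
containing `x` (other than `{x}`), and its vertices are the edges containing `x`. -/
def IsLocalIsometry {V : Type u} {W : Type v} (X : SquareComplex V) (Y : SquareComplex W)
    (f : V → W) : Prop :=
  X.IsCombinatorial Y f ∧
  ∀ x, {x} ∈ X.cells →
    (∀ c ∈ X.cells, ∀ c' ∈ X.cells, x ∈ c → x ∈ c' → f '' c = f '' c' → c = c') ∧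
    (∀ d ∈ Y.cells, f x ∈ d →
      (∀ e ∈ Y.cells, f x ∈ e → e ⊆ d → e.ncard = 2 → ∃ c ∈ X.cells, x ∈ c ∧ f '' c = e) →
      ∃ c ∈ X.cells, x ∈ c ∧ f '' c = d)

/-- `f : G × H → Y` is a standard product structure: `G` and `H` are connected leafless graphs with
at least one edge, and `f` is a local isometry that is an isomorphism onto its image on some slice
in each of the two directions. -/
def IsStandardProductStructure {A : Type u} {B : Type v} {W : Type*} (G : SimpleGraph A)
    (H : SimpleGraph B) (Y : SquareComplex W) (f : A × B → W) : Prop :=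
  G.Connected ∧ H.Connected ∧ (∃ a a', G.Adj a a') ∧ (∃ b b', H.Adj b b') ∧
  G.IsLeafless ∧ H.IsLeafless ∧
  (SquareComplex.prod G H).IsLocalIsometry Y f ∧
  (∃ b, Function.Injective fun a => f (a, b)) ∧ (∃ a, Function.Injective fun b => f (a, b))

/-- A standard product subcomplex (given by its set of cells): the image of a standard product
structure. -/
def IsStandardProduct {W : Type u} (Y : SquareComplex W) (K : Set (Set W)) : Prop :=
  ∃ (A B : Type u) (G : SimpleGraph A) (H : SimpleGraph B) (f : A × B → W),
    IsStandardProductStructure G H Y f ∧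
    K = (fun c => f '' c) '' (SquareComplex.prod G H).cells

/-- A maximal product subcomplex: a standard product subcomplex that is maximal with respect to
inclusion among standard product subcomplexes. -/
def IsMaximalProduct {W : Type u} (Y : SquareComplex W) (M : Set (Set W)) : Prop :=
  Maximal Y.IsStandardProduct M

theorem exists_opposite {V : Type u} (X : SquareComplex V) {c : Set V} (hc : c ∈ X.cells)
    (h4 : c.ncard = 4) {x : V} (hx : x ∈ c) : ∃ y ∈ c, y ≠ x ∧ {x, y} ∉ X.cells := by
  rcases X.shape c hc with ⟨a, rfl⟩ | ⟨a, b, hab, rfl⟩ | ⟨a, b, p, q, hn, rfl, -, -, -, -, h1, h2⟩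
  · simp at h4
  · rw [Set.ncard_pair hab] at h4; omega
  · have h1' := Set.pair_comm a p ▸ h1
    have h2' := Set.pair_comm b q ▸ h2
    simp at hn
    rcases hx with rfl | rfl | rfl | rfl
    · exact ⟨p, by simp, by grind, h1⟩
    · exact ⟨q, by simp, by grind, h2⟩
    · exact ⟨a, by simp, by grind, h1'⟩
    · exact ⟨b, by simp, by grind, h2'⟩

theorem ncard_four {V : Type u} {x y z w : V} (h : [x, y, z, w].Nodup) :
    ({x, y, z, w} : Set V).ncard = 4 := by
  classical
  simp at h
  have : ({x, y, z, w} : Set V) = (({x, y, z, w} : Finset V) : Set V) := by simp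
  rw [this, Set.ncard_coe_finset]
  rw [Finset.card_insert_of_notMem (by simp; grind), Finset.card_insert_of_notMem (by simp; grind),
    Finset.card_insert_of_notMem (by simp; grind), Finset.card_singleton]

/-- The image of a combinatorial map is closed under passing to faces. -/
theorem IsCombinatorial.exists_face {V : Type u} {W : Type v} {X : SquareComplex V}
    {Y : SquareComplex W} {f : V → W} (hf : X.IsCombinatorial Y f) {c : Set V}
    (hc : c ∈ X.cells) {d : Set W} (hd : d ∈ Y.cells) (hdc : d ⊆ f '' c) :
    ∃ c' ∈ X.cells, f '' c' = d := by
  obtain ⟨hfc, hinj⟩ := hf c hc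
  rcases Y.shape d hd with ⟨p, rfl⟩ | ⟨p, q, hpq, rfl⟩ | ⟨p, q, r, s, hn, rfl, -⟩
  · obtain ⟨a, ha, rfl⟩ := hdc rfl
    exact ⟨{a}, X.singleton_mem c hc a ha, by simp⟩
  · obtain ⟨a, ha, rfl⟩ := hdc (by simp : p ∈ _)
    obtain ⟨b, hb, rfl⟩ := hdc (by simp : q ∈ _)
    have hab : a ≠ b := fun h => hpq (h ▸ rfl)
    suffices {a, b} ∈ X.cells from ⟨_, this, by simp [Set.image_pair]⟩
    rcases X.shape c hc with ⟨x, rfl⟩ | ⟨x, y, hxy, rfl⟩ |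
      ⟨x, y, z, w, hn, rfl, e1, e2, e3, e4, -, -⟩
    · simp at ha hb; exact absurd (ha.trans hb.symm) hab
    · simp only [Set.mem_insert_iff, Set.mem_singleton_iff] at ha hb
      rcases ha with rfl | rfl <;> rcases hb with rfl | rfl
      · exact absurd rfl hab
      · exact hc
      · exact Set.pair_comm _ _ ▸ hc
      · exact absurd rfl hab
    · have h4 : (f '' {x, y, z, w}).ncard = 4 := by
        rw [hinj.ncard_image, ncard_four hn]
      by_contra hno
      obtain ⟨o, ho, hoa, hocell⟩ := Y.exists_opposite hfc h4 (Set.mem_image_of_mem f ha)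
      obtain ⟨t, ht, rfl⟩ := ho
      have hta : t ≠ a := fun h => hoa (h ▸ rfl)
      have htb : t ≠ b := fun h => hocell (h ▸ hd)
      have htcell : {a, t} ∉ X.cells := fun h => hocell (by
        have := (hf _ h).1
        rwa [Set.image_pair] at this)
      have e1' := Set.pair_comm x y ▸ e1
      have e2' := Set.pair_comm y z ▸ e2
      have e3' := Set.pair_comm z w ▸ e3
      have e4' := Set.pair_comm w x ▸ e4
      simp only [Set.mem_insert_iff, Set.mem_singleton_iff] at ha hb ht
      rcases ha with rfl | rfl | rfl | rfl <;> rcases hb with rfl | rfl | rfl | rfl <;>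
        rcases ht with rfl | rfl | rfl | rfl <;> first | contradiction
  · have hcard : (f '' c).ncard ≤ ({p, q, r, s} : Set W).ncard := by
      rw [ncard_four hn]
      rcases Y.shape _ hfc with ⟨x, h⟩ | ⟨x, y, hxy, h⟩ | ⟨x, y, z, w, hn', h, -⟩
      · rw [h]; simp
      · rw [h, Set.ncard_pair hxy]; norm_num
      · rw [h, ncard_four hn']
    have hfin : (f '' c).Finite := by
      rcases Y.shape _ hfc with ⟨x, h⟩ | ⟨x, y, hxy, h⟩ | ⟨x, y, z, w, hn', h, -⟩ <;>
        rw [h] <;> exact Set.toFinite _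
    exact ⟨c, hc, (Set.eq_of_subset_of_ncard_le hdc hcard hfin).symm⟩

/-- The subcomplex formed by a set of cells that is closed under passing to faces. -/
def restrict {V : Type u} (Y : SquareComplex V) (S : Set (Set V)) (hS : S ⊆ Y.cells)
    (hface : ∀ c ∈ S, ∀ d ∈ Y.cells, d ⊆ c → d ∈ S) : SquareComplex V where
  cells := S
  singleton_mem c hc x hx := hface c hc _ (Y.singleton_mem c (hS hc) x hx) (by simpa using hx)
  shape c hc := by
    rcases Y.shape c (hS hc) with h | h | ⟨x, y, z, w, hn, rfl, e1, e2, e3, e4, h1, h2⟩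
    · exact Or.inl h
    · exact Or.inr (Or.inl h)
    · refine Or.inr (Or.inr ⟨x, y, z, w, hn, rfl, hface _ hc _ e1 ?_, hface _ hc _ e2 ?_,
        hface _ hc _ e3 ?_, hface _ hc _ e4 ?_, fun h => h1 (hS h), fun h => h2 (hS h)⟩) <;>
      · intro t ht; simp at ht ⊢; tauto

theorem IsStandardProduct.subset_cells {W : Type u} {Y : SquareComplex W} {K : Set (Set W)}
    (hK : Y.IsStandardProduct K) : K ⊆ Y.cells := by
  obtain ⟨A, B, G, H, f, hf, rfl⟩ := hK
  rintro _ ⟨c, hc, rfl⟩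
  exact (hf.2.2.2.2.2.2.1.1 c hc).1

theorem IsStandardProduct.face_mem {W : Type u} {Y : SquareComplex W} {K : Set (Set W)}
    (hK : Y.IsStandardProduct K) {c d : Set W} (hc : c ∈ K) (hd : d ∈ Y.cells) (hdc : d ⊆ c) :
    d ∈ K := by
  obtain ⟨A, B, G, H, f, hf, rfl⟩ := hK
  obtain ⟨c, hc, rfl⟩ := hc
  obtain ⟨c', hc', h⟩ := hf.2.2.2.2.2.2.1.1.exists_face hc hd hdc
  exact ⟨c', hc', h⟩

/-- The subcomplex of `Y` that is the union of all maximal product subcomplexes of `Y`. -/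
def maxUnion {W : Type u} (Y : SquareComplex W) : SquareComplex W :=
  Y.restrict {c | ∃ M, Y.IsMaximalProduct M ∧ c ∈ M}
    (fun _ ⟨_, hM, hc⟩ => hM.1.subset_cells hc)
    (fun _ ⟨M, hM, hc⟩ _ hd hdc => ⟨M, hM, hM.1.face_mem hc hd hdc⟩)

/-! ### The intersection complex -/

/-- The vertices of the intersection complex: the maximal product subcomplexes. -/
def MaximalProduct {W : Type u} (X : SquareComplex W) : Type u :=
  {M : Set (Set W) // X.IsMaximalProduct M}

/-- The simplices of the intersection complex of `X`: a nonempty finite collection of maximal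
product subcomplexes spans one simplex for each standard product subcomplex `K` which is maximal
among the standard product subcomplexes contained in the intersection of the collection. -/
@[ext]
structure IntersectionSimplex {W : Type u} (X : SquareComplex W) where
  verts : Finset X.MaximalProduct
  label : Set (Set W)
  nonempty : verts.Nonempty
  isMaximal : Maximal (fun K => X.IsStandardProduct K ∧ ∀ M ∈ verts, K ⊆ M.1) label

/-- The face relation: `σ` is a face of `τ` if the vertices of `σ` are among those of `τ` and the
standard product subcomplex of `σ` contains that of `τ`. -/
instance {W : Type u} (X : SquareComplex W) : PartialOrder X.IntersectionSimplex where
  le σ τ := σ.verts ⊆ τ.verts ∧ τ.label ⊆ σ.label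
  le_refl _ := ⟨Finset.Subset.refl _, subset_rfl⟩
  le_trans _ _ _ h h' := ⟨h.1.trans h'.1, h'.2.trans h.2⟩
  le_antisymm _ _ h h' := IntersectionSimplex.ext (h.1.antisymm h'.1) (h'.2.antisymm h.2)

/-- The closed geometric simplex, in barycentric coordinates, of a simplex of the intersection
complex. -/
def IntersectionSimplex.Points {W : Type u} {X : SquareComplex W} (σ : X.IntersectionSimplex) :
    Type u :=
  {t : X.MaximalProduct → ℝ // (∀ M, 0 ≤ t M) ∧ (∀ M, M ∉ σ.verts → t M = 0) ∧
    ∑ M ∈ σ.verts, t M = 1}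

instance {W : Type u} {X : SquareComplex W} (σ : X.IntersectionSimplex) :
    TopologicalSpace σ.Points :=
  inferInstanceAs (TopologicalSpace {_t : X.MaximalProduct → ℝ // _})

/-- The gluing relation: a point of a face is identified with the same point of the simplex. -/
def GlueRel {W : Type u} (X : SquareComplex W) (p q : Σ σ : X.IntersectionSimplex, σ.Points) :
    Prop :=
  p.1 ≤ q.1 ∧ p.2.1 = q.2.1

/-- The intersection complex `I(X)` as a topological space: the disjoint union of its closed
simplices, glued along faces. -/
def IntersectionComplex {W : Type u} (X : SquareComplex W) : Type u :=
  Quot X.GlueRel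

instance {W : Type u} (X : SquareComplex W) : TopologicalSpace X.IntersectionComplex :=
  inferInstanceAs (TopologicalSpace (Quot X.GlueRel))

/-- The intersection complex of `X` is a simplex: its face poset is that of the `n`-simplex for
some `n`, i.e. the poset of nonempty subsets of a set with `n + 1` elements. -/
def IntersectionComplexIsSimplex {W : Type u} (X : SquareComplex W) : Prop :=
  ∃ n : ℕ, Nonempty (X.IntersectionSimplex ≃o {s : Finset (Fin (n + 1)) // s.Nonempty})

end SquareComplex

/-- `UP₂(G)`: the union of the maximal product subcomplexes of `UD₂(G)`. -/
def SimpleGraph.UP2 {V : Type u} (G : SimpleGraph V) : SquareComplex (Sym2 V) :=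
  G.UD2.maxUnion

/-! ### Bunches of grapes -/

/-- A bunch of grapes `(T, ℓ)`: a tree `T`, the stem, together with the number `ℓ v` of grapes
(3-cycles) attached to each vertex `v`. -/
structure BunchOfGrapes (V : Type u) where
  stem : SimpleGraph V
  isTree : stem.IsTree
  loops : V → ℕ

namespace BunchOfGrapes

variable {V : Type u} (Γ : BunchOfGrapes V)

/-- The vertices of the bunch of grapes as a graph: the vertices of the stem, and two further
vertices for each grape `⟨v, i⟩`, the `i`-th grape at `v`. -/
abbrev Vertex : Type u := V ⊕ (Σ v : V, Fin (Γ.loops v)) × Bool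

/-- The underlying simple graph: the stem with `ℓ v` triangles attached at each vertex `v`. -/
def graph : SimpleGraph Γ.Vertex where
  Adj
    | .inl v, .inl w => Γ.stem.Adj v w
    | .inl v, .inr (g, _) => g.1 = v
    | .inr (g, _), .inl v => g.1 = v
    | .inr (g, b), .inr (g', b') => g = g' ∧ b ≠ b'
  symm := ⟨by
    rintro (v | ⟨g, b⟩) (w | ⟨g', b'⟩) h
    · exact Γ.stem.adj_symm h
    · exact h
    · exact h
    · exact ⟨h.1.symm, h.2.symm⟩⟩
  loopless := ⟨by
    rintro (v | ⟨g, b⟩) h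
    · exact Γ.stem.irrefl h
    · exact h.2 rfl⟩

/-- A minimal simplicial model: each bivalent vertex of the stem carries at least one grape. -/
def IsMinimal : Prop :=
  ∀ v, (Γ.stem.neighborSet v).ncard = 2 → 1 ≤ Γ.loops v

/-- Large: grapes are attached to at least two distinct vertices of the stem. -/
def IsLarge : Prop :=
  ∃ v w, v ≠ w ∧ 0 < Γ.loops v ∧ 0 < Γ.loops w

/-- Normal: large, and each leaf of the stem carries at least one grape. -/
def IsNormal : Prop :=
  Γ.IsLarge ∧ ∀ v, (Γ.stem.neighborSet v).ncard = 1 → 1 ≤ Γ.loops v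

end BunchOfGrapes

/-! ### A criterion for a space not to be simply connected -/

/-! The maximal product subcomplexes correspond to the edges of the stem. Deleting an edge `uw` cuts
the bunch of grapes into two disjoint pieces; minimality and normality make both connected and
leafless (`isFactor_fiber_side`), so they span a standard product. Conversely, in a product of
graphs mapped to the configuration space, each factor moves its own point independently of the
other, so every standard product lies in one spanned by two disjoint connected leafless subgraphs
(`exists_isFactor_of_isStandardProduct`). Such subgraphs contain stem vertices, and an edge on the
stem path between them separates them (`exists_edge_of_isFactor`). Distinct edges give incomparable
products. The argument applies to `UD2` and then to `UP2` (`IsAmple.isMaximalProduct_iff`).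

If the stem is a path, its edges are linearly ordered, and the products of a set of edges meet
exactly in the product of what lies before the first edge and what lies after the last one. This is
again a standard product, so every nonempty set of vertices spans exactly one simplex, and the
intersection complex is a closed simplex, hence contractible.

If the stem is not a path, some vertex `v` has three neighbours, each with its branch. Colour a
maximal product 0 or 1 if its edge touches branch 0 or 1, and 2 otherwise. The three edges at `v`
have the three colours and are pairwise joined by simplices, since the product of two branches lies
in both edge products. No simplex has all three colours: a configuration common to its vertices
would have one point in branch 0 and the other in branch 1, and an edge touching neither branch does
not separate these. Adding barycentric coordinates by colour thus maps the complex to the boundary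
of a triangle, and the loop through the three edges at `v` winds around it once
(`not_simplyConnectedSpace_of_coloring`). -/

/-- If the sides of a hollow triangle in `X` are mapped to the sides of the triangle with corners
`1`, `-1 + i`, `-1 - i` by a nowhere vanishing function, then `X` is not simply connected. -/
theorem not_simplyConnectedSpace_of_triangle {X : Type*} [TopologicalSpace X] (Φ : X → ℂ)
    (hΦ : Continuous Φ) (hne : ∀ x, Φ x ≠ 0) {a b c : X} (p : Path a b) (q : Path b c)
    (r : Path a c)
    (hp : ∀ t : unitInterval, Φ (p t) = ⟨1 - 2 * t, t⟩)
    (hq : ∀ t : unitInterval, Φ (q t) = ⟨-1, 1 - 2 * t⟩)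
    (hr : ∀ t : unitInterval, Φ (r t) = ⟨1 - 2 * t, -t⟩) : ¬ SimplyConnectedSpace X := by
  intro _
  have hom : (p.trans q).Homotopic r := SimplyConnectedSpace.paths_homotopic _ _
  have key : ∀ {z : ℂ}, z ≠ 0 → Complex.exp (Complex.log z) = z := Complex.exp_log
  -- the lifts of the three sides
  have hpc : Continuous fun t : unitInterval => Complex.log (Φ (p t)) := by
    refine Continuous.clog (by fun_prop) fun t => ?_
    rw [hp, Complex.mem_slitPlane_iff]
    by_cases h : (t : ℝ) = 0
    · left; simp [h]
    · right; simpa using h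
  have hrc : Continuous fun t : unitInterval => Complex.log (Φ (r t)) := by
    refine Continuous.clog (by fun_prop) fun t => ?_
    rw [hr, Complex.mem_slitPlane_iff]
    by_cases h : (t : ℝ) = 0
    · left; simp [h]
    · right; simpa using h
  -- The second side crosses the cut of the principal logarithm. Its negative has real part 1 and so
  -- avoids the cut; adding `π * I` corrects the branch.
  have hqc : Continuous fun t : unitInterval => Complex.log (-Φ (q t)) + Real.pi * Complex.I := by
    refine (Continuous.clog (by fun_prop) fun t => ?_).add continuous_const
    rw [hq, Complex.mem_slitPlane_iff]
    left; simp
  have hb : Complex.log (-Φ b) + Real.pi * Complex.I = Complex.log (Φ b) := by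
    have h1 : Φ b = ⟨-1, 1⟩ := by
      have := hp 1
      simp at this
      rw [this]; norm_num
    have h2 : 0 < (Φ b).im := by simp [h1]
    apply Complex.ext
    · simp [Complex.log_re]
    · simp [Complex.log_im, Complex.arg_neg_eq_arg_sub_pi_of_im_pos h2]
  let P : Path (Complex.log (Φ a)) (Complex.log (Φ b)) :=
    ⟨⟨fun t => Complex.log (Φ (p t)), hpc⟩, by simp, by simp⟩
  let Q : Path (Complex.log (Φ b)) (Complex.log (-Φ c) + Real.pi * Complex.I) :=
    ⟨⟨fun t => Complex.log (-Φ (q t)) + Real.pi * Complex.I, hqc⟩, by simp [hb], by simp⟩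
  let R : Path (Complex.log (Φ a)) (Complex.log (Φ c)) :=
    ⟨⟨fun t => Complex.log (Φ (r t)), hrc⟩, by simp, by simp⟩
  -- A homotopy of the two paths, composed with `Φ`, lifts through `exp`, so the lifts `P.trans Q`
  -- and `R` would have the same endpoint.
  have cov := Complex.isCoveringMap_exp
  let Ψ : C(X, {z : ℂ // z ≠ 0}) := ⟨fun x => ⟨Φ x, hne x⟩, by fun_prop⟩
  have lift : ((P.trans Q : Path _ _) : C(unitInterval, ℂ)).HomotopicRel
      (R : C(unitInterval, ℂ)) {0, 1} := by
    rw [cov.homotopicRel_iff_comp ⟨0, by simp, by simp⟩]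
    have : (Ψ.comp (p.trans q : C(unitInterval, X))).HomotopicRel (Ψ.comp (r : C(unitInterval, X))) {0, 1} :=
      ⟨hom.some.compContinuousMap Ψ⟩
    convert this using 1
    · ext t
      simp only [ContinuousMap.comp_apply, ContinuousMap.coe_mk]
      rw [Path.trans_apply, Path.trans_apply]
      split_ifs
      · exact key (hne _)
      · simp only [Q, Path.coe_mk_mk, Complex.exp_add, Complex.exp_pi_mul_I]
        rw [key (neg_ne_zero.2 (hne _))]
        simp [Ψ]
    · ext t
      exact key (hne _)
  obtain ⟨F⟩ := lift
  have h2 := F.eq_fst 0 (x := 1) (by simp)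
  have h3 := F.eq_snd 0 (x := 1) (by simp)
  have h4 : Complex.log (-Φ c) + Real.pi * Complex.I = Complex.log (Φ c) := by
    have := h2.symm.trans h3
    simpa using this
  have hc : Φ c = ⟨-1, -1⟩ := by
    have := hr 1
    simp at this
    rw [this]; norm_num
  have h5 := congrArg Complex.im h4
  simp only [Complex.add_im, Complex.log_im, Complex.mul_im, Complex.ofReal_re, Complex.I_im,
    Complex.ofReal_im, Complex.I_re] at h5
  -- The lift along two sides ends at imaginary part `arg (-Φ c) + π`, which exceeds `π`, while the
  -- lift along the third side ends at `arg (Φ c)`, at most `π`.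
  have h6 := Complex.arg_le_pi (Φ c)
  have h7 : 0 < (-Φ c).arg := by
    rw [lt_iff_le_and_ne, Complex.arg_nonneg_iff]
    refine ⟨by simp [hc], fun h => ?_⟩
    have := Complex.arg_eq_zero_iff.1 h.symm
    simp [hc] at this
  linarith

namespace SquareComplex

/-! ### The topology of the intersection complex -/

variable {W : Type u} {X : SquareComplex W}

theorem MaximalProduct.maximal (M : X.MaximalProduct) :
    Maximal (fun K => X.IsStandardProduct K ∧ ∀ N ∈ ({M} : Finset X.MaximalProduct), K ⊆ N.1)
      M.1 :=
  ⟨⟨M.2.1, by simp⟩, fun _ hK _ => hK.2 M (by simp)⟩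

/-- The simplex of dimension zero given by a maximal product subcomplex. -/
def MaximalProduct.simplex (M : X.MaximalProduct) : X.IntersectionSimplex :=
  ⟨{M}, M.1, by simp, M.maximal⟩

theorem MaximalProduct.simplex_le {M : X.MaximalProduct} {σ : X.IntersectionSimplex}
    (h : M ∈ σ.verts) : M.simplex ≤ σ :=
  ⟨by simpa [simplex] using h, σ.isMaximal.1.2 M h⟩

open Classical in
/-- The point of a closed simplex at the parameter `t` on the segment between two vertices. -/
noncomputable def IntersectionSimplex.segment (σ : X.IntersectionSimplex) {M N : X.MaximalProduct}
    (hM : M ∈ σ.verts) (hN : N ∈ σ.verts) (t : unitInterval) : σ.Points :=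
  ⟨(1 - t : ℝ) • Pi.single M 1 + (t : ℝ) • Pi.single N 1, by
    have := t.2.1
    have := t.2.2
    refine ⟨fun L => ?_, fun L hL => ?_, ?_⟩
    · have h1 : (0 : ℝ) ≤ (Pi.single M 1 : X.MaximalProduct → ℝ) L := by
        rw [Pi.single_apply]; split_ifs <;> norm_num
      have h2 : (0 : ℝ) ≤ (Pi.single N 1 : X.MaximalProduct → ℝ) L := by
        rw [Pi.single_apply]; split_ifs <;> norm_num
      simp only [Pi.add_apply, Pi.smul_apply, smul_eq_mul]
      have : 0 ≤ 1 - (t : ℝ) := by linarith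
      positivity
    · have h1 : L ≠ M := fun h => hL (h ▸ hM)
      have h2 : L ≠ N := fun h => hL (h ▸ hN)
      simp [h1, h2]
    · simp [Finset.sum_add_distrib, Pi.single_apply, hM, hN]⟩

theorem IntersectionSimplex.continuous_segment (σ : X.IntersectionSimplex)
    {M N : X.MaximalProduct} (hM : M ∈ σ.verts) (hN : N ∈ σ.verts) :
    Continuous (σ.segment hM hN) :=
  Continuous.subtype_mk (by fun_prop) _

/-- The point of the intersection complex given by a point of a closed simplex. -/
def IntersectionSimplex.toComplex (σ : X.IntersectionSimplex) (p : σ.Points) :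
    X.IntersectionComplex :=
  Quot.mk _ ⟨σ, p⟩

theorem IntersectionSimplex.continuous_toComplex (σ : X.IntersectionSimplex) :
    Continuous σ.toComplex :=
  continuous_quot_mk.comp continuous_sigmaMk

theorem IntersectionSimplex.toComplex_eq {σ τ : X.IntersectionSimplex} (h : σ ≤ τ) {p : σ.Points}
    {q : τ.Points} (hpq : p.1 = q.1) : σ.toComplex p = τ.toComplex q :=
  Quot.sound ⟨h, hpq⟩

/-- The vertex of the intersection complex given by a maximal product subcomplex. -/
noncomputable def MaximalProduct.point (M : X.MaximalProduct) : X.IntersectionComplex :=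
  M.simplex.toComplex
    (M.simplex.segment (M := M) (N := M) (by simp [simplex]) (by simp [simplex]) 0)

/-- The edge between two vertices of a simplex as a path in the intersection complex. -/
noncomputable def IntersectionSimplex.path (σ : X.IntersectionSimplex) {M N : X.MaximalProduct}
    (hM : M ∈ σ.verts) (hN : N ∈ σ.verts) : Path M.point N.point where
  toFun t := σ.toComplex (σ.segment hM hN t)
  continuous_toFun := σ.continuous_toComplex.comp (σ.continuous_segment hM hN)
  source' := (toComplex_eq (MaximalProduct.simplex_le hM) (by simp [segment])).symm
  target' := (toComplex_eq (MaximalProduct.simplex_le hN) (by simp [segment])).symm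

/-- The barycentric coordinates of a point of the intersection complex. -/
def IntersectionComplex.coord (x : X.IntersectionComplex) : X.MaximalProduct → ℝ :=
  Quot.lift (fun p => p.2.1) (fun _ _ h => h.2) x

theorem IntersectionComplex.continuous_coord :
    Continuous (IntersectionComplex.coord : X.IntersectionComplex → _) :=
  continuous_quot_lift _ (continuous_sigma fun _ => continuous_subtype_val)

/-- A `3`-colouring of the vertices of the intersection complex for which no simplex has all
colours, but some simplices have any two of them, obstructs simple connectedness. -/
theorem not_simplyConnectedSpace_of_coloring [Finite W] (color : X.MaximalProduct → Fin 3)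
    (hcolor : ∀ σ : X.IntersectionSimplex, ∃ k, ∀ M ∈ σ.verts, color M ≠ k)
    (M : Fin 3 → X.MaximalProduct) (hM : ∀ k, color (M k) = k)
    (hσ : ∀ i j, ∃ σ : X.IntersectionSimplex, M i ∈ σ.verts ∧ M j ∈ σ.verts) :
    ¬ SimplyConnectedSpace X.IntersectionComplex := by
  classical
  have : Finite X.MaximalProduct := Subtype.finite
  have := Fintype.ofFinite X.MaximalProduct
  let m : Fin 3 → (X.MaximalProduct → ℝ) → ℝ := fun k t => ∑ N with color N = k, t N
  have hm : ∀ k, Continuous (m k) := fun k => by fun_prop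
  let Φ : X.IntersectionComplex → ℂ := fun x =>
    ⟨m 0 x.coord - m 1 x.coord - m 2 x.coord, m 1 x.coord - m 2 x.coord⟩
  have hΦ : Continuous Φ := by
    have h : ∀ k, Continuous fun x : X.IntersectionComplex => m k x.coord := fun k =>
      (hm k).comp IntersectionComplex.continuous_coord
    have : Φ = fun x => ((m 0 x.coord - m 1 x.coord - m 2 x.coord : ℝ) : ℂ) +
        ((m 1 x.coord - m 2 x.coord : ℝ) : ℂ) * Complex.I := by
      funext x
      apply Complex.ext <;> simp [Φ]
    rw [this]
    exact (Complex.continuous_ofReal.comp (((h 0).sub (h 1)).sub (h 2))).add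
      ((Complex.continuous_ofReal.comp ((h 1).sub (h 2))).mul continuous_const)
  -- With total mass 1, `Φ` vanishes only at colour masses `1/2, 1/4, 1/4`, whereas on each simplex
  -- some colour has mass 0.
  have hne : ∀ x, Φ x ≠ 0 := by
    rintro ⟨σ, t, h0, h1, h2⟩ h
    have e1 : m 0 t - m 1 t - m 2 t = 0 := congrArg Complex.re h
    have e2 : m 1 t - m 2 t = 0 := congrArg Complex.im h
    have e3 : m 0 t + m 1 t + m 2 t = 1 := by
      have : ∑ N, t N = 1 := by
        rw [← h2]
        exact (Finset.sum_subset (Finset.subset_univ _) fun N _ hN => h1 N hN).symm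
      rw [← this, ← Finset.sum_fiberwise (s := Finset.univ) (g := color), Fin.sum_univ_three]
    obtain ⟨k, hk⟩ := hcolor σ
    have e4 : m k t = 0 := Finset.sum_eq_zero fun N hN => h1 N fun hN' =>
      hk N hN' (by simpa using hN)
    fin_cases k <;> simp at e4 <;> linarith
  have hseg : ∀ i j k (σ : X.IntersectionSimplex) (hi : M i ∈ σ.verts) (hj : M j ∈ σ.verts)
      (t : unitInterval), m k (IntersectionComplex.coord (σ.path hi hj t)) =
        (1 - t) * (if i = k then 1 else 0) + t * (if j = k then 1 else 0) := by
    intro i j k σ hi hj t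
    change ∑ N with color N = k, ((1 - t : ℝ) • (Pi.single (M i) 1 : X.MaximalProduct → ℝ) +
      (t : ℝ) • (Pi.single (M j) 1 : X.MaximalProduct → ℝ)) N = _
    simp [Finset.sum_add_distrib, Pi.single_apply, hM]
  obtain ⟨σ, hσ0, hσ1⟩ := hσ 0 1
  obtain ⟨τ, hτ1, hτ2⟩ := hσ 1 2
  obtain ⟨ρ, hρ0, hρ2⟩ := hσ 0 2
  refine not_simplyConnectedSpace_of_triangle Φ hΦ hne (σ.path hσ0 hσ1) (τ.path hτ1 hτ2)
    (ρ.path hρ0 hρ2) ?_ ?_ ?_ <;>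
  · intro t
    apply Complex.ext <;> (simp [Φ, hseg]; try ring)

/-- The poset has a greatest element. Every closed simplex is glued into that one, so the complex is
homeomorphic to its closed simplex, which is convex. -/
theorem IntersectionComplexIsSimplex.simplyConnectedSpace (h : X.IntersectionComplexIsSimplex) :
    SimplyConnectedSpace X.IntersectionComplex := by
  obtain ⟨n, ⟨e⟩⟩ := h
  let top : X.IntersectionSimplex := e.symm ⟨Finset.univ, Finset.univ_nonempty⟩
  have htop : ∀ σ, σ ≤ top := fun σ => by
    rw [e.le_symm_apply]
    exact Finset.subset_univ _
  have mem : ∀ {σ τ : X.IntersectionSimplex} (_ : σ ≤ τ) (p : σ.Points),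
      (∀ M, 0 ≤ p.1 M) ∧ (∀ M, M ∉ τ.verts → p.1 M = 0) ∧ ∑ M ∈ τ.verts, p.1 M = 1 := by
    intro σ τ hστ p
    refine ⟨p.2.1, fun M hM => p.2.2.1 M fun h => hM (hστ.1 h), ?_⟩
    exact (Finset.sum_subset hστ.1 fun N _ hN => p.2.2.1 N hN).symm.trans p.2.2.2
  let g : X.IntersectionComplex → top.Points :=
    Quot.lift (fun p => ⟨p.2.1, mem (htop _) p.2⟩) fun p q h => Subtype.ext h.2
  have hg : Continuous g :=
    continuous_quot_lift _ (continuous_sigma fun _ => continuous_subtype_val.subtype_mk _)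
  let E : X.IntersectionComplex ≃ₜ top.Points :=
    { toFun := g
      invFun := top.toComplex
      left_inv := by
        rintro ⟨σ, p⟩
        exact (IntersectionSimplex.toComplex_eq (htop σ) rfl).symm
      right_inv := fun p => rfl
      continuous_toFun := hg
      continuous_invFun := top.continuous_toComplex }
  have : ContractibleSpace top.Points := by
    refine Convex.contractibleSpace (s := {t : X.MaximalProduct → ℝ | (∀ M, 0 ≤ t M) ∧
      (∀ M, M ∉ top.verts → t M = 0) ∧ ∑ M ∈ top.verts, t M = 1}) ?_ ?_
    · rintro s ⟨s0, s1, s2⟩ t ⟨t0, t1, t2⟩ a b ha hb hab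
      refine ⟨fun M => ?_, fun M hM => ?_, ?_⟩
      · have := s0 M
        have := t0 M
        simp only [Pi.add_apply, Pi.smul_apply, smul_eq_mul]
        positivity
      · simp [s1 M hM, t1 M hM]
      · simp [Finset.sum_add_distrib, ← Finset.mul_sum, s2, t2, hab]
    · obtain ⟨M, hM⟩ := top.nonempty
      exact ⟨_, (top.segment hM hM 0).2⟩
  exact E.toHomotopyEquiv.simplyConnectedSpace

/-- If the maximal product subcomplexes are finite in number, and any nonempty collection of them
intersects in a standard product subcomplex, then the intersection complex is a simplex. -/
theorem intersectionComplexIsSimplex_of_equiv {n : ℕ} (e : X.MaximalProduct ≃ Fin (n + 1))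
    (h : ∀ S : Finset X.MaximalProduct, S.Nonempty →
      X.IsStandardProduct {c | ∀ M ∈ S, c ∈ M.1}) :
    X.IntersectionComplexIsSimplex := by
  -- The intersection is itself a standard product, hence the only maximal one inside it: labels are
  -- determined by vertex sets.
  have hlabel : ∀ σ : X.IntersectionSimplex, σ.label = {c | ∀ M ∈ σ.verts, c ∈ M.1} := fun σ =>
    subset_antisymm (fun c hc M hM => σ.isMaximal.1.2 M hM hc)
      (σ.isMaximal.2 ⟨h _ σ.nonempty, fun M hM c hc => hc M hM⟩
        (fun c hc M hM => σ.isMaximal.1.2 M hM hc))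
  refine ⟨n, ⟨?_⟩⟩
  exact
    { toFun := fun σ => ⟨σ.verts.map e.toEmbedding, σ.nonempty.map⟩
      invFun := fun s => ⟨s.1.map e.symm.toEmbedding, _, s.2.map,
        ⟨⟨h _ s.2.map, fun M hM c hc => hc M hM⟩, fun K hK _ c hc M hM => hK.2 M hM hc⟩⟩
      left_inv := fun σ => by
        have : (σ.verts.map e.toEmbedding).map e.symm.toEmbedding = σ.verts := by
          ext; simp
        apply IntersectionSimplex.ext
        · exact this
        · simp only [this, hlabel σ]
      right_inv := fun s => by
        apply Subtype.ext
        ext; simp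
      map_rel_iff' := by
        intro σ τ
        change σ.verts.map _ ⊆ τ.verts.map _ ↔ _ ∧ _
        rw [Finset.map_subset_map]
        refine ⟨fun hs => ⟨hs, ?_⟩, fun hs => hs.1⟩
        rw [hlabel σ, hlabel τ]
        exact fun c hc M hM => hc M (hs hM) }

end SquareComplex

/-! ### Product subcomplexes of discrete configuration spaces -/

namespace SimpleGraph

variable {V : Type u} {G : SimpleGraph V}

theorem pair_mem_cells {v w : V} (h : G.Adj v w) : {v, w} ∈ G.cells :=
  Or.inr ⟨v, w, h, rfl⟩

theorem nonempty_of_mem_cells {s : Set V} (h : s ∈ G.cells) : s.Nonempty := by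
  rcases h with ⟨v, rfl⟩ | ⟨v, w, -, rfl⟩ <;> simp

theorem adj_of_mem_cells {s : Set V} (h : s ∈ G.cells) {v w : V} (hv : v ∈ s) (hw : w ∈ s)
    (hvw : v ≠ w) : G.Adj v w := by
  rcases h with ⟨x, rfl⟩ | ⟨x, y, hxy, rfl⟩
  · exact absurd (hv.trans hw.symm) hvw
  · rcases hv with rfl | rfl <;> rcases hw with rfl | rfl
    · exact absurd rfl hvw
    · exact hxy
    · exact hxy.symm
    · exact absurd rfl hvw

/-- The unordered pairs with one point in `A` and one in `B`. -/
def crossPairs (A B : Set V) : Set (Sym2 V) :=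
  Set.image2 (fun x y => s(x, y)) A B

theorem mem_crossPairs {A B : Set V} {x y : V} :
    s(x, y) ∈ crossPairs A B ↔ (x ∈ A ∧ y ∈ B) ∨ (x ∈ B ∧ y ∈ A) := by
  constructor
  · rintro ⟨a, ha, b, hb, h⟩
    simp only [Sym2.eq_iff] at h
    grind
  · rintro (⟨h1, h2⟩ | ⟨h1, h2⟩)
    · exact ⟨x, h1, y, h2, rfl⟩
    · exact ⟨y, h2, x, h1, Sym2.eq_swap⟩

theorem crossPairs_comm (A B : Set V) : crossPairs A B = crossPairs B A := by
  ext p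
  induction p with
  | _ x y => rw [mem_crossPairs, mem_crossPairs, or_comm]

theorem crossPairs_mono {A B A' B' : Set V} (hA : A ⊆ A') (hB : B ⊆ B') :
    crossPairs A B ⊆ crossPairs A' B' :=
  Set.image2_subset hA hB

/-- The cells of the discrete configuration space whose vertices have one point in `A` and one
in `B`. -/
def fullProduct (G : SimpleGraph V) (A B : Set V) : Set (Set (Sym2 V)) :=
  {c | c ∈ G.configCells ∧ c ⊆ crossPairs A B}

/-- One pair decides which set lies in `A` and which in `B`; disjointness forces every other pair to
agree with it. -/
theorem crossPairs_subset_of_disjoint {A B σ τ : Set V} (hAB : Disjoint A B) (hσ : σ.Nonempty)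
    (hτ : τ.Nonempty) (h : crossPairs σ τ ⊆ crossPairs A B) :
    (σ ⊆ A ∧ τ ⊆ B) ∨ (σ ⊆ B ∧ τ ⊆ A) := by
  obtain ⟨x, hx⟩ := hσ
  obtain ⟨y, hy⟩ := hτ
  have key : ∀ p ∈ σ, ∀ q ∈ τ, (p ∈ A ∧ q ∈ B) ∨ (p ∈ B ∧ q ∈ A) := fun p hp q hq =>
    mem_crossPairs.1 (h ⟨p, hp, q, hq, rfl⟩)
  have hd : ∀ z, z ∈ A → z ∈ B → False := fun z h1 h2 => Set.disjoint_left.1 hAB h1 h2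
  rcases key x hx y hy with h1 | h1
  · left
    exact ⟨fun p hp => by have := key p hp y hy; grind, fun q hq => by have := key x hx q hq; grind⟩
  · right
    exact ⟨fun p hp => by have := key p hp y hy; grind, fun q hq => by have := key x hx q hq; grind⟩

/-- A set of vertices that spans a connected leafless graph with at least one edge. -/
def IsFactor (G : SimpleGraph V) (A : Set V) : Prop :=
  (G.induce A).Connected ∧ (∃ a a', (G.induce A).Adj a a') ∧ (G.induce A).IsLeafless

theorem mem_cells_induce {A : Set V} {s : Set A} :
    s ∈ (G.induce A).cells ↔ Subtype.val '' s ∈ G.cells := by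
  constructor
  · rintro (⟨v, rfl⟩ | ⟨v, w, h, rfl⟩)
    · exact Or.inl ⟨v, by simp⟩
    · exact Or.inr ⟨v, w, h, by simp [Set.image_pair]⟩
  · intro h
    obtain ⟨v, hv⟩ := (Set.image_nonempty.1 (nonempty_of_mem_cells h))
    rcases h with ⟨x, hx⟩ | ⟨x, y, h, hx⟩
    · left
      refine ⟨v, Set.eq_singleton_iff_unique_mem.2 ⟨hv, fun w hw => ?_⟩⟩
      have h1 : w.1 ∈ ({x} : Set V) := hx ▸ ⟨w, hw, rfl⟩
      have h2 : v.1 ∈ ({x} : Set V) := hx ▸ ⟨v, hv, rfl⟩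
      exact Subtype.ext (h1.trans h2.symm)
    · right
      obtain ⟨x', hx', rfl⟩ : x ∈ Subtype.val '' s := hx ▸ (by simp)
      obtain ⟨y', hy', rfl⟩ : y ∈ Subtype.val '' s := hx ▸ (by simp)
      refine ⟨x', y', h, ?_⟩
      apply Set.image_injective.2 Subtype.val_injective
      rw [hx, Set.image_pair]

theorem image_prod_eq_crossPairs {A B : Set V} (s : Set A) (t : Set B) :
    (fun p : A × B => s(p.1.1, p.2.1)) '' (s ×ˢ t) =
      crossPairs (Subtype.val '' s) (Subtype.val '' t) := by
  ext p
  constructor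
  · rintro ⟨⟨a, b⟩, ⟨ha, hb⟩, rfl⟩
    exact ⟨a, ⟨a, ha, rfl⟩, b, ⟨b, hb, rfl⟩, rfl⟩
  · rintro ⟨_, ⟨a, ha, rfl⟩, _, ⟨b, hb, rfl⟩, rfl⟩
    exact ⟨(a, b), ⟨ha, hb⟩, rfl⟩

/-- Because `A` and `B` are disjoint, a cell with vertices in `crossPairs A B` is, up to order, a
cell in `A` times a cell in `B`. -/
theorem fullProduct_eq_image {A B : Set V} (hAB : Disjoint A B) :
    G.fullProduct A B = (fun c => (fun p : A × B => s(p.1.1, p.2.1)) '' c) ''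
      (SquareComplex.prod (G.induce A) (G.induce B)).cells := by
  have lift : ∀ {S : Set V} {σ : Set V}, σ ⊆ S → Subtype.val '' {x : S | x.1 ∈ σ} = σ := by
    intro S σ h
    ext x
    simpa using fun hx => h hx
  have key : ∀ {σ τ : Set V}, σ ∈ G.cells → τ ∈ G.cells → σ ⊆ A → τ ⊆ B →
      crossPairs σ τ ∈ (fun c => (fun p : A × B => s(p.1.1, p.2.1)) '' c) ''
        (SquareComplex.prod (G.induce A) (G.induce B)).cells := by
    intro σ τ hσ hτ hA hB
    refine ⟨_, ⟨{x : A | x.1 ∈ σ}, ?_, {x : B | x.1 ∈ τ}, ?_, rfl⟩, ?_⟩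
    · rwa [mem_cells_induce, lift hA]
    · rwa [mem_cells_induce, lift hB]
    · change (fun p : A × B => s(p.1.1, p.2.1)) '' _ = _
      rw [image_prod_eq_crossPairs, lift hA, lift hB]
  apply subset_antisymm
  · rintro _ ⟨⟨σ, hσ, τ, hτ, hd, rfl⟩, hc⟩
    rcases crossPairs_subset_of_disjoint hAB (nonempty_of_mem_cells hσ) (nonempty_of_mem_cells hτ)
      hc with ⟨h1, h2⟩ | ⟨h1, h2⟩
    · exact key hσ hτ h1 h2
    · have := key hτ hσ h2 h1
      rwa [crossPairs_comm] at this
  · rintro _ ⟨_, ⟨s, hs, t, ht, rfl⟩, rfl⟩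
    change (fun p : A × B => s(p.1.1, p.2.1)) '' _ ∈ _
    rw [image_prod_eq_crossPairs]
    have h1 : Subtype.val '' s ⊆ A := by simp
    have h2 : Subtype.val '' t ⊆ B := by simp
    exact ⟨⟨_, mem_cells_induce.1 hs, _, mem_cells_induce.1 ht, hAB.mono h1 h2, rfl⟩,
      crossPairs_mono h1 h2⟩

theorem injective_mk_of_disjoint {A B : Set V} (hAB : Disjoint A B) :
    Function.Injective fun p : A × B => s(p.1.1, p.2.1) := by
  rintro ⟨⟨a, ha⟩, ⟨b, hb⟩⟩ ⟨⟨a', ha'⟩, ⟨b', hb'⟩⟩ h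
  simp only [Sym2.eq_iff] at h
  rcases h with ⟨rfl, rfl⟩ | ⟨rfl, rfl⟩
  · rfl
  · exact absurd hb' (Set.disjoint_left.1 hAB ha)

/-- Disjoint factors span a standard product subcomplex. -/
theorem isStandardProduct_fullProduct {Y : SquareComplex (Sym2 V)}
    (hsub : Y.cells ⊆ G.configCells)
    (hface : ∀ c ∈ Y.cells, ∀ d ∈ G.configCells, d ⊆ c → d ∈ Y.cells) {A B : Set V}
    (hA : G.IsFactor A) (hB : G.IsFactor B) (hAB : Disjoint A B)
    (hY : G.fullProduct A B ⊆ Y.cells) : Y.IsStandardProduct (G.fullProduct A B) := by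
  have hinj := injective_mk_of_disjoint hAB
  refine ⟨A, B, G.induce A, G.induce B, fun p => s(p.1.1, p.2.1),
    ⟨hA.1, hB.1, hA.2.1, hB.2.1, hA.2.2, hB.2.2, ⟨?_, ?_⟩, ?_, ?_⟩, fullProduct_eq_image hAB⟩
  · exact fun c hc => ⟨hY (fullProduct_eq_image hAB ▸ ⟨c, hc, rfl⟩), hinj.injOn⟩
  · rintro ⟨⟨a, ha⟩, ⟨b, hb⟩⟩ -
    refine ⟨fun c _ c' _ _ _ h => Set.image_injective.2 hinj h, fun d hd hx he => ?_⟩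
    suffices d ∈ G.fullProduct A B by
      rw [fullProduct_eq_image hAB] at this
      obtain ⟨c, hc, rfl⟩ := this
      exact ⟨c, hc, (hinj.mem_set_image).1 hx, rfl⟩
    refine ⟨hsub hd, ?_⟩
    have he' : ∀ e ∈ Y.cells, s(a, b) ∈ e → e ⊆ d → e.ncard = 2 → e ⊆ crossPairs A B := by
      intro e h1 h2 h3 h4
      obtain ⟨c, hc, -, rfl⟩ := he e h1 h2 h3 h4
      rintro _ ⟨p, -, rfl⟩
      exact ⟨_, p.1.2, _, p.2.2, rfl⟩
    have hdis : ∀ z, z ∈ A → z ∈ B → False := fun z h1 h2 => Set.disjoint_left.1 hAB h1 h2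
    -- Moving one point of the configuration inside its cell runs along an edge of `d` at the given
    -- vertex, and by hypothesis that edge lies in the image. Applied to both points, this puts all
    -- of `d` in `crossPairs A B`.
    have key : ∀ {σ τ : Set V}, σ ∈ G.cells → Disjoint σ τ → crossPairs σ τ = d →
        ∀ {x y : V}, x ∈ σ → y ∈ τ → s(x, y) = s(a, b) → ∀ p ∈ σ, s(p, y) ∈ crossPairs A B := by
      intro σ τ hσ hστ hd' x y hx hy hxy p hp
      by_cases hpx : p = x
      · rw [hpx, hxy]; exact ⟨a, ha, b, hb, rfl⟩
      have hyx : y ≠ x := fun h => Set.disjoint_left.1 hστ hx (h ▸ hy)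
      have hyp : y ≠ p := fun h => Set.disjoint_left.1 hστ hp (h ▸ hy)
      have hcell := G.pair_mem_configCells (adj_of_mem_cells hσ hx hp (Ne.symm hpx)) hyx hyp
      have hsubd : ({s(y, x), s(y, p)} : Set (Sym2 V)) ⊆ d := by
        rw [← hd']
        rintro z (rfl | rfl)
        · exact ⟨x, hx, y, hy, Sym2.eq_swap⟩
        · exact ⟨p, hp, y, hy, Sym2.eq_swap⟩
      have := he' _ (hface d hd _ hcell hsubd) (by rw [← hxy, Sym2.eq_swap]; simp) hsubd
        (Set.ncard_pair (by rw [Ne, Sym2.congr_right]; exact Ne.symm hpx))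
      rw [Sym2.eq_swap]
      exact this (by simp)
    obtain ⟨σ, hσ, τ, hτ, hστ, rfl⟩ := hsub hd
    obtain ⟨x, hx, y, hy, hxy⟩ := hx
    change s(x, y) = s(a, b) at hxy
    rintro _ ⟨p, hp, q, hq, rfl⟩
    have h1 := mem_crossPairs.1 (key hσ hστ rfl hx hy hxy p hp)
    have h2 := mem_crossPairs.1 (key hτ hστ.symm (crossPairs_comm _ _) hy hx
      (by rw [← hxy, Sym2.eq_swap]) q hq)
    have h3 := mem_crossPairs.1 (show s(x, y) ∈ crossPairs A B from hxy ▸ ⟨a, ha, b, hb, rfl⟩)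
    rw [mem_crossPairs]
    grind
  · obtain ⟨b⟩ := hB.1.nonempty
    exact ⟨b, fun a a' h => (Prod.ext_iff.1 (hinj h)).1⟩
  · obtain ⟨a⟩ := hA.1.nonempty
    exact ⟨a, fun b b' h => (Prod.ext_iff.1 (hinj h)).2⟩

/-! ### Factors of an arbitrary standard product -/

theorem adj_of_pair_mem_configCells {x x' y : V} (h : {s(x, y), s(x', y)} ∈ G.configCells)
    (hx : x ≠ x') : G.Adj x x' := by
  obtain ⟨σ, hσ, τ, hτ, hd, h⟩ := h
  change _ = crossPairs σ τ at h
  have h1 : s(x, y) ∈ crossPairs σ τ := h ▸ (by simp)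
  have h2 : s(x', y) ∈ crossPairs σ τ := h ▸ (by simp)
  rw [mem_crossPairs] at h1 h2
  have hdis : ∀ z, z ∈ σ → z ∈ τ → False := fun z h1 h2 => Set.disjoint_left.1 hd h1 h2
  by_cases hy : y ∈ σ
  · exact adj_of_mem_cells hτ (v := x) (w := x') (by grind) (by grind) hx
  · exact adj_of_mem_cells hσ (v := x) (w := x') (by grind) (by grind) hx

/-- Four unordered pairs are the vertices of a square of the discrete configuration space, in the
given arrangement. -/
def IsConfigSquare (w x y z : Sym2 V) : Prop :=
  ∃ p p' q q', p ≠ p' ∧ q ≠ q' ∧ p ≠ q ∧ p ≠ q' ∧ p' ≠ q ∧ p' ≠ q' ∧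
    w = s(p, q) ∧ x = s(p', q) ∧ y = s(p, q') ∧ z = s(p', q')

/-- Four distinct vertices force both cells of the graph to be edges. Since diagonals are not cells,
the neighbours `x` and `y` of `w` each change one point, and distinctness makes them change
different ones. -/
theorem isSquare_of_mem_configCells {w x y z : Sym2 V} (h : {w, x, y, z} ∈ G.configCells)
    (hwx : {w, x} ∈ G.configCells) (hwy : {w, y} ∈ G.configCells) (hn : [w, x, y, z].Nodup) :
    IsConfigSquare w x y z := by
  obtain ⟨σ, hσ, τ, hτ, hd, h⟩ := h
  change _ = crossPairs σ τ at h
  have hdis : ∀ z, z ∈ σ → z ∈ τ → False := fun z h1 h2 => Set.disjoint_left.1 hd h1 h2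
  simp only [List.nodup_cons, List.mem_cons, List.not_mem_nil, or_false, not_or] at hn
  have mw : w ∈ crossPairs σ τ := h ▸ (by simp)
  have mx : x ∈ crossPairs σ τ := h ▸ (by simp)
  have my : y ∈ crossPairs σ τ := h ▸ (by simp)
  have mz : z ∈ crossPairs σ τ := h ▸ (by simp)
  rcases hσ with ⟨a, rfl⟩ | ⟨a, a', ha, rfl⟩
  · rcases hτ with ⟨b, rfl⟩ | ⟨b, b', hb, rfl⟩ <;>
    · simp only [crossPairs, Set.image2_singleton_left, Set.image_singleton, Set.image_pair,
        Set.mem_insert_iff, Set.mem_singleton_iff] at mw mx my mz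
      grind
  · rcases hτ with ⟨b, rfl⟩ | ⟨b, b', hb, rfl⟩
    · simp only [crossPairs, Set.image2_singleton_right, Set.image_pair,
        Set.mem_insert_iff, Set.mem_singleton_iff] at mw mx my mz
      grind
    obtain ⟨p, hp, q, hq, rfl⟩ := mw
    have hpq : ∃ p' q', p' ≠ p ∧ q' ≠ q ∧ ({a, a'} : Set V) = {p, p'} ∧
        ({b, b'} : Set V) = {q, q'} := by
      have h1 : ∃ p', p' ≠ p ∧ ({a, a'} : Set V) = {p, p'} := by
        rcases hp with rfl | rfl
        · exact ⟨a', ha.ne', rfl⟩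
        · exact ⟨a, ha.ne, Set.pair_comm _ _⟩
      have h2 : ∃ q', q' ≠ q ∧ ({b, b'} : Set V) = {q, q'} := by
        rcases hq with rfl | rfl
        · exact ⟨b', hb.ne', rfl⟩
        · exact ⟨b, hb.ne, Set.pair_comm _ _⟩
      obtain ⟨p', h1, h1'⟩ := h1
      obtain ⟨q', h2, h2'⟩ := h2
      exact ⟨p', q', h1, h2, h1', h2'⟩
    obtain ⟨p', q', hp', hq', ea, eb⟩ := hpq
    rw [ea, eb] at mx my mz hdis
    have d1 := hdis p (by simp)
    have d2 := hdis p' (by simp)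
    simp only [Set.mem_insert_iff, Set.mem_singleton_iff, imp_false, not_or] at d1 d2
    have hno := G.pair_notMem_configCells hp'.symm hq'.symm d1.1 d1.2 d2.1 d2.2
    simp only [crossPairs, Set.image2_insert_left, Set.image2_singleton_left, Set.image_pair,
      Set.mem_union, Set.mem_insert_iff, Set.mem_singleton_iff] at mx my mz
    have hx : x = s(p', q) ∨ x = s(p, q') := by
      rcases mx with (h | h) | (h | h)
      · exact absurd h.symm (by tauto)
      · exact Or.inr h
      · exact Or.inl h
      · exact absurd (h ▸ hwx) hno
    have hy : y = s(p', q) ∨ y = s(p, q') := by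
      rcases my with (h | h) | (h | h)
      · exact absurd h.symm (by tauto)
      · exact Or.inr h
      · exact Or.inl h
      · exact absurd (h ▸ hwy) hno
    have hz : z = s(p', q') := by grind
    rcases hx with rfl | rfl
    · exact ⟨p, p', q, q', by grind, by grind, d1.1, d1.2, d2.1, d2.2, rfl, rfl, by grind, hz⟩
    · exact ⟨q, q', p, p', by grind, by grind, Ne.symm d1.1, Ne.symm d2.1, Ne.symm d1.2,
        Ne.symm d2.2,
        Sym2.eq_swap, Sym2.eq_swap, by rw [Sym2.eq_swap]; grind, by rw [Sym2.eq_swap]; exact hz⟩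

theorem IsConfigSquare.flip {w x y z : Sym2 V} (h : IsConfigSquare w x y z) : IsConfigSquare w y x z := by
  obtain ⟨p, p', q, q', h1, h2, h3, h4, h5, h6, rfl, rfl, rfl, rfl⟩ := h
  exact ⟨q, q', p, p', h2, h1, h3.symm, h5.symm, h4.symm, h6.symm, Sym2.eq_swap, Sym2.eq_swap,
    Sym2.eq_swap, Sym2.eq_swap⟩

/-- A family of squares over a product of connected graphs: the points that move along the first
factor do not depend on the second. -/
theorem exists_forall_mem_of_isSquare {A B : Type*} {H : SimpleGraph A} {K : SimpleGraph B}
    (hK : K.Connected) (hKe : ∃ b b', K.Adj b b') {f : A → B → Sym2 V}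
    (hf : ∀ a a' b b', H.Adj a a' → K.Adj b b' →
      IsConfigSquare (f a b) (f a' b) (f a b') (f a' b')) {a a' : A} (ha : H.Adj a a') :
    ∃ p, ∀ b, p ∈ f a b := by
  obtain ⟨b₀, b₁, h₀⟩ := hKe
  obtain ⟨p, p', q, q', h1, h2, h3, h4, h5, h6, e1, e2, -⟩ := hf a a' b₀ b₁ ha h₀
  -- Following `a` and `a'` together makes the induction along a walk in `K` work: the change from
  -- `p` to `p'` singles out the moving point, and the next square keeps it.
  suffices ∀ b, ∃ q, f a b = s(p, q) ∧ f a' b = s(p', q) from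
    ⟨p, fun b => by obtain ⟨q, hq, -⟩ := this b; simp [hq]⟩
  intro b
  obtain ⟨w⟩ := hK.preconnected b₀ b
  have step : ∀ {b b' : B}, K.Adj b b' → (∃ q, f a b = s(p, q) ∧ f a' b = s(p', q)) →
      ∃ q, f a b' = s(p, q) ∧ f a' b' = s(p', q) := by
    rintro b b' hb ⟨q, hq, hq'⟩
    obtain ⟨P, P', Q, Q', k1, k2, k3, k4, k5, k6, i1, i2, i3, i4⟩ := hf a a' b b' ha hb
    rw [i1, Sym2.eq_iff] at hq
    rw [i2, Sym2.eq_iff] at hq'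
    refine ⟨Q', ?_, ?_⟩
    · rw [i3]; grind
    · rw [i4]; grind
  have hstart : ∃ q, f a b₀ = s(p, q) ∧ f a' b₀ = s(p', q) := ⟨q, e1, e2⟩
  clear e1 e2 h₀
  induction w with
  | nil => exact hstart
  | cons h w ih => exact ih (step h hstart)

theorem IsLeafless.exists_two_adj {A : Type*} {H : SimpleGraph A} (hl : H.IsLeafless)
    (hc : H.Connected) (he : ∃ a a', H.Adj a a') (a : A) :
    ∃ b c, b ≠ c ∧ H.Adj a b ∧ H.Adj a c := by
  obtain ⟨x, y, hxy⟩ := he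
  have : Nontrivial A := ⟨x, y, hxy.ne⟩
  obtain ⟨b, hb⟩ := SimpleGraph.Preconnected.exists_adj_of_nontrivial hc.preconnected a
  by_contra! h
  refine hl a (Set.ncard_eq_one.2 ⟨b, Set.eq_singleton_iff_unique_mem.2 ⟨hb, fun c hcb => ?_⟩⟩)
  by_contra hne
  exact h b c (Ne.symm hne) hb hcb

theorem isLeafless_of_exists_two_adj {A : Type*} {H : SimpleGraph A}
    (h : ∀ a, ∃ b c, b ≠ c ∧ H.Adj a b ∧ H.Adj a c) : H.IsLeafless := by
  intro a ha
  obtain ⟨x, hx⟩ := Set.ncard_eq_one.1 ha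
  obtain ⟨b, c, hbc, hb, hc⟩ := h a
  have h1 : b ∈ ({x} : Set A) := hx ▸ hb
  have h2 : c ∈ ({x} : Set A) := hx ▸ hc
  exact hbc (h1.trans h2.symm)

/-- The induced graph on the range may have more edges than the image of `H`, but extra edges
preserve connectedness and leave two neighbours at each vertex. -/
theorem isFactor_range {A : Type*} {H : SimpleGraph A} (hc : H.Connected)
    (he : ∃ a a', H.Adj a a') (hl : H.IsLeafless) (φ : H →g G) (hφ : Function.Injective φ) :
    G.IsFactor (Set.range φ) := by
  let ψ : H →g G.induce (Set.range φ) := ⟨fun a => ⟨φ a, a, rfl⟩, fun h => φ.map_adj h⟩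
  have hψ : Function.Surjective ψ := by
    rintro ⟨_, a, rfl⟩
    exact ⟨a, rfl⟩
  refine ⟨hc.map ψ hψ, ?_, isLeafless_of_exists_two_adj fun x => ?_⟩
  · obtain ⟨a, a', h⟩ := he
    exact ⟨_, _, ψ.map_adj h⟩
  · obtain ⟨a, rfl⟩ := hψ x
    obtain ⟨b, c, hbc, hb, hc'⟩ := hl.exists_two_adj hc he a
    exact ⟨ψ b, ψ c, fun h => hbc (hφ (congrArg Subtype.val h)), ψ.map_adj hb, ψ.map_adj hc'⟩

/-- Every standard product subcomplex is contained in the one spanned by disjoint factors. -/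
theorem exists_isFactor_of_isStandardProduct {Y : SquareComplex (Sym2 V)}
    (hsub : Y.cells ⊆ G.configCells) {K : Set (Set (Sym2 V))} (hK : Y.IsStandardProduct K) :
    ∃ A B, G.IsFactor A ∧ G.IsFactor B ∧ Disjoint A B ∧ K ⊆ G.fullProduct A B := by
  obtain ⟨A, B, H, H', f, ⟨hc, hc', he, he', hl, hl', ⟨hf, -⟩, ⟨b₀, hb₀⟩, ⟨a₀, ha₀⟩⟩, rfl⟩ := hK
  have cellA : ∀ {a a' : A}, H.Adj a a' → ∀ b, {f (a, b), f (a', b)} ∈ G.configCells := by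
    intro a a' h b
    have := (hf ({a, a'} ×ˢ {b}) ⟨_, pair_mem_cells h, _, Or.inl ⟨b, rfl⟩, rfl⟩).1
    rw [Set.prod_singleton, Set.image_pair, Set.image_pair] at this
    exact hsub this
  have cellB : ∀ {b b' : B}, H'.Adj b b' → ∀ a, {f (a, b), f (a, b')} ∈ G.configCells := by
    intro b b' h a
    have := (hf ({a} ×ˢ {b, b'}) ⟨_, Or.inl ⟨a, rfl⟩, _, pair_mem_cells h, rfl⟩).1
    rw [Set.singleton_prod, Set.image_pair, Set.image_pair] at this
    exact hsub this
  have sq : ∀ a a' b b', H.Adj a a' → H'.Adj b b' →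
      IsConfigSquare (f (a, b)) (f (a', b)) (f (a, b')) (f (a', b')) := by
    intro a a' b b' ha hb
    obtain ⟨h1, h2⟩ := hf ({a, a'} ×ˢ {b, b'}) ⟨_, pair_mem_cells ha, _, pair_mem_cells hb, rfl⟩
    have h3 : f '' ({a, a'} ×ˢ {b, b'}) = {f (a, b), f (a', b), f (a, b'), f (a', b')} := by
      rw [Set.insert_prod, Set.singleton_prod, Set.image_union, Set.image_image, Set.image_image,
        Set.image_pair, Set.image_pair]
      ext z
      simp only [Set.mem_union, Set.mem_insert_iff, Set.mem_singleton_iff]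
      tauto
    rw [h3] at h1
    refine isSquare_of_mem_configCells (hsub h1) (cellA ha b) (cellB hb a) ?_
    have hne : ∀ p ∈ ({a, a'} : Set A) ×ˢ ({b, b'} : Set B),
        ∀ q ∈ ({a, a'} : Set A) ×ˢ ({b, b'} : Set B), p ≠ q → f p ≠ f q :=
      fun p hp q hq hpq h => hpq (h2 hp hq h)
    have := ha.ne
    have := hb.ne
    simp only [List.nodup_cons, List.mem_cons, List.not_mem_nil, or_false, not_or, List.nodup_nil,
      not_false_eq_true, and_true]
    refine ⟨⟨hne _ ?_ _ ?_ ?_, hne _ ?_ _ ?_ ?_, hne _ ?_ _ ?_ ?_⟩,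
      ⟨hne _ ?_ _ ?_ ?_, hne _ ?_ _ ?_ ?_⟩, hne _ ?_ _ ?_ ?_⟩ <;> simp [*]
  have hφ : ∀ a, ∃ p, ∀ b, p ∈ f (a, b) := fun a => by
    obtain ⟨a', -, -, ha, -⟩ := hl.exists_two_adj hc he a
    exact exists_forall_mem_of_isSquare (f := fun a b => f (a, b)) hc' he' sq ha
  have hψ : ∀ b, ∃ q, ∀ a, q ∈ f (a, b) := fun b => by
    obtain ⟨b', -, -, hb, -⟩ := hl'.exists_two_adj hc' he' b
    exact exists_forall_mem_of_isSquare (f := fun b a => f (a, b)) hc he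
      (fun b b' a a' hb ha => (sq a a' b b' ha hb).flip) hb
  choose φ hφ using hφ
  choose ψ hψ using hψ
  -- In a square at `(a, b)`, the point `φ a` is the one shared by `f (a, b)` and `f (a, b')`,
  -- namely `p`, and `p` is not in `f (a', b)`, which contains `ψ b`.
  have hne : ∀ a b, φ a ≠ ψ b := by
    intro a b h
    obtain ⟨a', -, -, ha, -⟩ := hl.exists_two_adj hc he a
    obtain ⟨b', -, -, hb, -⟩ := hl'.exists_two_adj hc' he' b
    obtain ⟨p, p', q, q', h1, h2, h3, h4, h5, h6, e1, e2, e3, -⟩ := sq a a' b b' ha hb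
    have m1 := hφ a b
    have m2 := hψ b a'
    have m3 := hφ a b'
    rw [e1, Sym2.mem_iff] at m1
    rw [e2, Sym2.mem_iff] at m2
    rw [e3, Sym2.mem_iff] at m3
    grind
  have hfeq : ∀ a b, f (a, b) = s(φ a, ψ b) := fun a b =>
    ((Sym2.mem_and_mem_iff (hne a b)).1 ⟨hφ a b, hψ b a⟩)
  have injφ : Function.Injective φ := fun a a' h => hb₀ (by simp [hfeq, h])
  have injψ : Function.Injective ψ := fun b b' h => ha₀ (by simp [hfeq, h])
  let φ' : H →g G := ⟨φ, fun {a a'} h => adj_of_pair_mem_configCells (y := ψ b₀)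
    (by simpa [hfeq] using cellA h b₀) (injφ.ne h.ne)⟩
  let ψ' : H' →g G := ⟨ψ, fun {b b'} h => adj_of_pair_mem_configCells (y := φ a₀)
    (by simpa [hfeq, Sym2.eq_swap] using cellB h a₀) (injψ.ne h.ne)⟩
  refine ⟨Set.range φ, Set.range ψ, isFactor_range hc he hl φ' injφ,
    isFactor_range hc' he' hl' ψ' injψ, ?_, ?_⟩
  · rw [Set.disjoint_left]
    rintro _ ⟨a, rfl⟩ ⟨b, h⟩
    exact hne a b h.symm
  · rintro _ ⟨c, hcc, rfl⟩
    refine ⟨hsub (hf c hcc).1, ?_⟩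
    rintro _ ⟨⟨a, b⟩, -, rfl⟩
    exact ⟨φ a, ⟨a, rfl⟩, ψ b, ⟨b, rfl⟩, (hfeq a b).symm⟩

end SimpleGraph

/-! ### The sides of an edge of a tree -/

namespace SimpleGraph

variable {V : Type u} {T : SimpleGraph V}

/-- The side of `u` of the edge `uw`: the vertices connected to `u` by a walk that avoids the
edge. -/
def side (T : SimpleGraph V) (u w : V) : Set V :=
  {x | (T.deleteEdges {s(u, w)}).Reachable u x}

theorem self_mem_side (u w : V) : u ∈ T.side u w :=
  Reachable.refl u

theorem mem_side_of_adj {u w x y : V} (hx : x ∈ T.side u w) (h : T.Adj x y)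
    (hne : s(x, y) ≠ s(u, w)) : y ∈ T.side u w :=
  Reachable.trans hx (Adj.reachable (by rw [deleteEdges_adj]; exact ⟨h, hne⟩))

theorem mem_of_reachable {H : SimpleGraph V} {S : Set V}
    (hS : ∀ x y, x ∈ S → H.Adj x y → y ∈ S) {x y : V} (h : H.Reachable x y) (hx : x ∈ S) :
    y ∈ S := by
  obtain ⟨p⟩ := h
  induction p with
  | nil => exact hx
  | cons h _ ih => exact ih (hS _ _ hx h)

theorem side_subset {u w : V} {S : Set V} (hu : u ∈ S)
    (hS : ∀ x y, x ∈ S → T.Adj x y → s(x, y) ≠ s(u, w) → y ∈ S) : T.side u w ⊆ S := by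
  intro x hx
  refine mem_of_reachable (fun a b ha hab => ?_) hx hu
  rw [deleteEdges_adj] at hab
  exact hS a b ha hab.1 hab.2

theorem IsTree.disjoint_side (hT : T.IsTree) {u w : V} (h : T.Adj u w) :
    Disjoint (T.side u w) (T.side w u) := by
  rw [Set.disjoint_left]
  intro x h1 h2
  have hb := isAcyclic_iff_forall_adj_isBridge.1 hT.isAcyclic h
  rw [isBridge_iff] at hb
  have h2' : (T.deleteEdges {s(w, u)}).Reachable w x := h2
  rw [Sym2.eq_swap] at h2'
  exact hb (Reachable.trans h1 h2'.symm)

theorem IsTree.mem_side_or (hT : T.IsTree) (u w x : V) : x ∈ T.side u w ∨ x ∈ T.side w u := by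
  refine mem_of_reachable (S := T.side u w ∪ T.side w u) (fun a b ha hab => ?_)
    (hT.connected.preconnected u x) (Or.inl (self_mem_side u w))
  by_cases hne : s(a, b) = s(u, w)
  · rcases Sym2.eq_iff.1 hne with ⟨-, rfl⟩ | ⟨-, rfl⟩
    · exact Or.inr (self_mem_side _ _)
    · exact Or.inl (self_mem_side _ _)
  · rcases ha with ha | ha
    · exact Or.inl (mem_side_of_adj ha hab hne)
    · exact Or.inr (mem_side_of_adj ha hab (by rwa [Sym2.eq_swap (a := w)]))

/-- A side that does not contain the edge `uw` lies on one side of that edge. -/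
theorem side_subset_side {p q u w : V} (h : u ∉ T.side p q ∨ w ∉ T.side p q)
    (hp : p ∈ T.side u w) : T.side p q ⊆ T.side u w := by
  -- Walks kept inside `T.side p q` miss an endpoint of `uw`, so they never cross that edge.
  suffices T.side p q ⊆ T.side u w ∩ T.side p q from fun x hx => (this hx).1
  refine side_subset ⟨hp, self_mem_side p q⟩ ?_
  rintro x y ⟨h1, h2⟩ hxy hne
  have h3 := mem_side_of_adj h2 hxy hne
  refine ⟨mem_side_of_adj h1 hxy fun he => ?_, h3⟩
  rcases Sym2.eq_iff.1 he with ⟨rfl, rfl⟩ | ⟨rfl, rfl⟩ <;> tauto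

/-- A path that leaves a set does so along an edge that has the endpoint on its far side. -/
theorem Walk.IsPath.exists_boundary_side {S : Set V} {a b : V} {p : T.Walk a b} (hp : p.IsPath)
    (ha : a ∈ S) (hb : b ∉ S) : ∃ u w, T.Adj u w ∧ u ∈ S ∧ w ∉ S ∧ b ∈ T.side w u := by
  induction p with
  | nil => exact absurd ha hb
  | @cons a c b h p ih =>
    rw [Walk.cons_isPath_iff] at hp
    by_cases hc : c ∈ S
    · exact ih hp.1 hc hb
    -- The rest of the path never returns to `a`, so it joins `c` to `b` without the edge `ac`.
    · refine ⟨a, c, h, ha, hc, ?_⟩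
      change (T.deleteEdges {s(c, a)}).Reachable c b
      rw [reachable_deleteEdges_iff_exists_walk]
      exact ⟨p, fun he => hp.2 (p.snd_mem_support_of_mem_edges he)⟩

/-- A finite tree without vertices of valency greater than two is a path. -/
theorem IsTree.exists_iso_pathGraph [Finite V] (hT : T.IsTree)
    (h : ¬ ∃ (v : V) (n : Fin 3 → V), Function.Injective n ∧ ∀ k, T.Adj v (n k)) :
    ∃ n : ℕ, Nonempty (T ≃g pathGraph n) := by
  have := hT.connected.nonempty
  -- A longest path visits every vertex: a neighbour off the path would extend it at an end, or be a
  -- third neighbour of an interior vertex.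
  obtain ⟨u, v, p, hp, hmax⟩ := Walk.exists_isPath_forall_isPath_length_le_length T
  have three : ∀ {x a b c : V}, T.Adj x a → T.Adj x b → T.Adj x c → a ≠ b → a ≠ c → b ≠ c →
      False := by
    intro x a b c ha hb hc hab hac hbc
    refine h ⟨x, ![a, b, c], ?_, fun k => by fin_cases k <;> simpa⟩
    intro i j hij
    fin_cases i <;> fin_cases j <;> simp_all
  have hinj : ∀ {i j : ℕ}, i ≤ p.length → j ≤ p.length → p.getVert i = p.getVert j → i = j :=
    fun hi hj hij => hp.getVert_injOn hi hj hij
  have hsupp : ∀ x, x ∈ p.support := by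
    intro x
    refine mem_of_reachable (S := {x | x ∈ p.support}) (fun a b ha hab => ?_)
      (hT.connected.preconnected u x) p.start_mem_support
    by_contra hb
    obtain ⟨i, rfl, hi⟩ := Walk.mem_support_iff_exists_getVert.1 ha
    have hb' : ∀ j, p.getVert j ≠ b := fun j hj => hb (hj ▸ p.getVert_mem_support j)
    rcases Nat.eq_zero_or_pos i with rfl | hi0
    · rw [Walk.getVert_zero] at hab
      have := hmax _ _ (Walk.cons hab.symm p) (hp.cons hb)
      simp at this
    rcases hi.lt_or_eq with hi1 | rfl
    · have e1 := p.adj_getVert_succ hi1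
      have e2 := p.adj_getVert_succ (show i - 1 < p.length by omega)
      rw [Nat.sub_add_cancel hi0] at e2
      refine three e1 e2.symm hab (fun h => ?_) (hb' _) (hb' _)
      have := hinj (by omega) (by omega) h
      omega
    · rw [Walk.getVert_length] at hab
      have := hmax _ _ (Walk.cons hab.symm p.reverse) (hp.reverse.cons (by simpa using hb))
      simp at this
  -- A chord would not be a bridge, since the stretch of the path between its ends avoids it.
  have hadj : ∀ i j : ℕ, i < j → j ≤ p.length → T.Adj (p.getVert i) (p.getVert j) →
      i + 1 = j := by
    intro i j hij hj hA
    by_contra hne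
    have key : ∀ k, i + k ≤ j → p.getVert (i + k) ∈ T.side (p.getVert i) (p.getVert j) := by
      intro k
      induction k with
      | zero => exact fun _ => self_mem_side _ _
      | succ k ih =>
        intro hk
        refine mem_side_of_adj (ih (by omega)) (p.adj_getVert_succ (by omega)) fun he => ?_
        rcases Sym2.eq_iff.1 he with ⟨h1, h2⟩ | ⟨h1, h2⟩
        · have := hinj (by omega) (by omega) h1
          have := hinj (by omega) (by omega) h2
          omega
        · have := hinj (by omega) (by omega) h1
          omega
    have := key (j - i) (by omega)
    rw [Nat.add_sub_cancel' hij.le] at this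
    exact Set.disjoint_left.1 (hT.disjoint_side hA) this (self_mem_side _ _)
  let f : Fin (p.length + 1) → V := fun i => p.getVert i
  have hf : Function.Bijective f := by
    refine ⟨fun i j hij => Fin.ext (hinj (by omega) (by omega) hij), fun x => ?_⟩
    obtain ⟨i, hi, hi'⟩ := Walk.mem_support_iff_exists_getVert.1 (hsupp x)
    exact ⟨⟨i, by omega⟩, hi⟩
  refine ⟨p.length + 1, ⟨RelIso.symm ⟨Equiv.ofBijective f hf, ?_⟩⟩⟩
  intro i j
  rw [pathGraph_adj]
  change T.Adj (p.getVert i) (p.getVert j) ↔ _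
  constructor
  · intro hA
    rcases lt_trichotomy i.1 j.1 with hij | hij | hij
    · exact Or.inl (hadj _ _ hij (by omega) hA)
    · exact absurd (congrArg p.getVert hij) hA.ne
    · exact Or.inr (hadj _ _ hij (by omega) hA.symm)
  · rintro (hij | hij)
    · rw [← hij]; exact p.adj_getVert_succ (by omega)
    · rw [← hij]; exact (p.adj_getVert_succ (by omega)).symm

end SimpleGraph

/-! ### The maximal product subcomplexes of a bunch of grapes -/

namespace BunchOfGrapes

open SimpleGraph

variable {V : Type u} {Γ : BunchOfGrapes V}

/-- The vertex of the stem that a vertex of the bunch of grapes belongs to. -/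
def base (x : Γ.Vertex) : V :=
  x.elim id fun g => g.1.1

theorem base_eq_or_of_adj {x y : Γ.Vertex} (h : Γ.graph.Adj x y) :
    base x = base y ∨ ∃ v w, Γ.stem.Adj v w ∧ x = .inl v ∧ y = .inl w := by
  rcases x with v | ⟨g, b⟩ <;> rcases y with w | ⟨g', b'⟩
  · exact Or.inr ⟨v, w, h, rfl, rfl⟩
  · exact Or.inl (Eq.symm h)
  · exact Or.inl h
  · exact Or.inl (congrArg Sigma.fst h.1)

/-- The part of the bunch of grapes over a set of vertices of the stem. -/
def fiber (Γ : BunchOfGrapes V) (S : Set V) : Set Γ.Vertex :=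
  base ⁻¹' S

theorem fiber_mono {S S' : Set V} (h : S ⊆ S') : Γ.fiber S ⊆ Γ.fiber S' :=
  Set.preimage_mono h

/-- A grape vertex off the stem has only two neighbours, its twin and the stem vertex; a leafless
subgraph through it must contain both. -/
theorem inl_base_mem_of_isFactor {A : Set Γ.Vertex} (hA : Γ.graph.IsFactor A) {x : Γ.Vertex}
    (hx : x ∈ A) : (.inl (base x) : Γ.Vertex) ∈ A := by
  rcases x with v | ⟨g, b⟩
  · exact hx
  obtain ⟨⟨y, hy⟩, ⟨z, hz⟩, hyz, h1, h2⟩ := hA.2.2.exists_two_adj hA.1 hA.2.1 ⟨_, hx⟩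
  rw [Ne, Subtype.mk.injEq] at hyz
  rcases y with v | ⟨g', b'⟩
  · have : g.1 = v := h1
    subst this
    exact hy
  rcases z with w | ⟨g'', b''⟩
  · have : g.1 = w := h2
    subst this
    exact hz
  · obtain ⟨rfl, h3⟩ : g = g' ∧ b ≠ b' := h1
    obtain ⟨rfl, h4⟩ : g = g'' ∧ b ≠ b'' := h2
    exact absurd (by rw [Bool.eq_not_of_ne h3.symm, Bool.eq_not_of_ne h4.symm]) hyz

/-- A factor that does not contain the edge `uw` lies on one side of that edge. -/
theorem subset_fiber_side {A : Set Γ.Vertex} (hA : Γ.graph.IsFactor A) {u w : V}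
    (h : (.inl u : Γ.Vertex) ∉ A ∨ (.inl w : Γ.Vertex) ∉ A) {x : Γ.Vertex} (hx : x ∈ A)
    (hxu : base x ∈ Γ.stem.side u w) : A ⊆ Γ.fiber (Γ.stem.side u w) := by
  intro y hy
  refine mem_of_reachable (S := {z : A | base z.1 ∈ Γ.stem.side u w}) ?_
    (hA.1.preconnected ⟨x, hx⟩ ⟨y, hy⟩) hxu
  rintro ⟨a, ha⟩ ⟨b, hb⟩ hab' hab
  rcases base_eq_or_of_adj hab with he | ⟨p, q, hpq, hp, hq⟩
  · exact Set.mem_ofPred.2 (he ▸ hab')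
  · simp only [Function.Embedding.subtype_apply] at hp hq
    subst hp hq
    refine mem_side_of_adj hab' hpq fun he => ?_
    rcases Sym2.eq_iff.1 he with ⟨rfl, rfl⟩ | ⟨rfl, rfl⟩ <;> tauto

/-- Disjoint factors are separated by an edge of the stem. -/
theorem exists_edge_of_isFactor {A B : Set Γ.Vertex} (hA : Γ.graph.IsFactor A)
    (hB : Γ.graph.IsFactor B) (hAB : Disjoint A B) :
    ∃ u w, Γ.stem.Adj u w ∧ A ⊆ Γ.fiber (Γ.stem.side u w) ∧ B ⊆ Γ.fiber (Γ.stem.side w u) := by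
  obtain ⟨⟨a, ha⟩⟩ := hA.1.nonempty
  obtain ⟨⟨b, hb⟩⟩ := hB.1.nonempty
  have ha' := inl_base_mem_of_isFactor hA ha
  have hb' := inl_base_mem_of_isFactor hB hb
  -- The separating edge is one along which the stem path from `A` to `B` leaves `A`. It is
  -- contained in neither factor, so each factor stays on one side of it.
  obtain ⟨p, hp, -⟩ := Γ.isTree.existsUnique_path (base a) (base b)
  obtain ⟨u, w, huw, hu, hw, hbw⟩ := hp.exists_boundary_side (S := {v | (.inl v : Γ.Vertex) ∈ A}) ha'
    (fun h => Set.disjoint_left.1 hAB h hb')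
  exact ⟨u, w, huw, subset_fiber_side hA (Or.inr hw) hu (self_mem_side u w),
    subset_fiber_side hB (Or.inr (Set.disjoint_left.1 hAB hu)) hb hbw⟩

/-- The point is leaflessness at a stem vertex. If it carries a grape, that supplies two neighbours.
Otherwise normality excludes valency 1 and minimality valency 2, so at least three stem edges meet
there, and at most one of them leaves the side. -/
theorem isFactor_fiber_side [Finite V] (hmin : Γ.IsMinimal) (hnormal : Γ.IsNormal) {u w : V}
    (h : Γ.stem.Adj u w) : Γ.graph.IsFactor (Γ.fiber (Γ.stem.side u w)) := by
  have hroot : (.inl u : Γ.Vertex) ∈ Γ.fiber (Γ.stem.side u w) := self_mem_side u w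
  have hconn : (Γ.graph.induce (Γ.fiber (Γ.stem.side u w))).Connected := by
    have hstem : Γ.stem.side u w ⊆ {v | ∃ hv : (.inl v : Γ.Vertex) ∈ Γ.fiber (Γ.stem.side u w),
        (Γ.graph.induce (Γ.fiber (Γ.stem.side u w))).Reachable ⟨_, hroot⟩ ⟨_, hv⟩} := by
      refine side_subset ⟨hroot, Reachable.refl _⟩ ?_
      rintro x y ⟨hx, hr⟩ hxy hne
      exact ⟨mem_side_of_adj hx hxy hne, hr.trans (Adj.reachable hxy)⟩
    have hall : ∀ x, (Γ.graph.induce (Γ.fiber (Γ.stem.side u w))).Reachable ⟨_, hroot⟩ x := by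
      rintro ⟨x, hx⟩
      obtain ⟨hv, hr⟩ := hstem hx
      rcases x with v | ⟨g, b⟩
      · exact hr
      · exact hr.trans (Adj.reachable (show Γ.graph.Adj (.inl g.1) (.inr (g, b)) from rfl))
    have : Nonempty (Γ.fiber (Γ.stem.side u w)) := ⟨⟨_, hroot⟩⟩
    exact ⟨fun x y => (hall x).symm.trans (hall y)⟩
  have htwo : ∀ x, ∃ y z, y ≠ z ∧ (Γ.graph.induce (Γ.fiber (Γ.stem.side u w))).Adj x y ∧
      (Γ.graph.induce (Γ.fiber (Γ.stem.side u w))).Adj x z := by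
    rintro ⟨v | ⟨g, b⟩, hx⟩
    · by_cases hv : 1 ≤ Γ.loops v
      · exact ⟨⟨.inr (⟨v, 0, hv⟩, true), hx⟩, ⟨.inr (⟨v, 0, hv⟩, false), hx⟩,
          fun h' => by simpa using congrArg Subtype.val h',
          (rfl : v = v), (rfl : v = v)⟩
      have hvu : v ∈ Γ.stem.side u w := hx
      have hvw : v ≠ w := fun h' => Set.disjoint_left.1 (Γ.isTree.disjoint_side h) hvu
        (by rw [h']; exact self_mem_side w u)
      have h1 : (Γ.stem.neighborSet v).ncard ≠ 1 := fun h' => hv (hnormal.2 v h')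
      have h2 : (Γ.stem.neighborSet v).ncard ≠ 2 := fun h' => hv (hmin v h')
      have h0 : (Γ.stem.neighborSet v).ncard ≠ 0 := by
        have : Nontrivial V := ⟨v, w, hvw⟩
        obtain ⟨y, hy⟩ := SimpleGraph.Preconnected.exists_adj_of_nontrivial
          Γ.isTree.connected.preconnected v
        exact Set.ncard_ne_zero_of_mem (a := y) hy
      have h3 : 1 < (Γ.stem.neighborSet v \ {w}).ncard := by
        have := Set.pred_ncard_le_ncard_sdiff_singleton (Γ.stem.neighborSet v) w
        omega
      obtain ⟨y, ⟨hy, hyw⟩, z, ⟨hz, hzw⟩, hyz⟩ := (Set.one_lt_ncard).1 h3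
      have mem : ∀ y, Γ.stem.Adj v y → y ≠ w → y ∈ Γ.stem.side u w := fun y hy hyw =>
        mem_side_of_adj hvu hy fun he => by
          rcases Sym2.eq_iff.1 he with ⟨-, h'⟩ | ⟨h', -⟩
          · exact hyw h'
          · exact hvw h'
      exact ⟨⟨.inl y, mem y hy hyw⟩, ⟨.inl z, mem z hz hzw⟩,
        fun h' => hyz (Sum.inl_injective (congrArg Subtype.val h')), hy, hz⟩
    · refine ⟨⟨.inl g.1, hx⟩, ⟨.inr (g, !b), hx⟩,
        fun h' => by simpa using congrArg Subtype.val h', (rfl : g.1 = g.1), ?_⟩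
      exact (⟨rfl, by simp⟩ : g = g ∧ b ≠ !b)
  obtain ⟨y, -, -, hy, -⟩ := htwo ⟨_, hroot⟩
  exact ⟨hconn, ⟨_, y, hy⟩, isLeafless_of_exists_two_adj htwo⟩

/-! ### Maximal products and edges of the stem -/

theorem disjoint_fiber {S S' : Set V} (h : Disjoint S S') : Disjoint (Γ.fiber S) (Γ.fiber S') :=
  h.preimage _

/-- The product subcomplex given by an edge of the stem. -/
def edgeProduct (Γ : BunchOfGrapes V) (u w : V) : Set (Set (Sym2 Γ.Vertex)) :=
  Γ.graph.fullProduct (Γ.fiber (Γ.stem.side u w)) (Γ.fiber (Γ.stem.side w u))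

theorem edgeProduct_comm (u w : V) : Γ.edgeProduct u w = Γ.edgeProduct w u := by
  rw [edgeProduct, fullProduct, crossPairs_comm]; rfl

theorem vertex_mem_configCells {u w : V} (h : Γ.stem.Adj u w) :
    {s(.inl u, .inl w)} ∈ Γ.graph.configCells :=
  ⟨{.inl u}, Or.inl ⟨_, rfl⟩, {.inl w}, Or.inl ⟨_, rfl⟩, by simpa using h.ne, by simp⟩

/-- The configuration with one point at each end of `uw` detects the edge: any other edge has `u`
and `w` on the same side. -/
theorem eq_of_edgeProduct_subset {u w u' w' : V} (h : Γ.stem.Adj u w) (h' : Γ.stem.Adj u' w')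
    (hsub : Γ.edgeProduct u w ⊆ Γ.edgeProduct u' w') : s(u, w) = s(u', w') := by
  have h1 : ({s(.inl u, .inl w)} : Set (Sym2 Γ.Vertex)) ∈ Γ.edgeProduct u w := by
    refine ⟨vertex_mem_configCells h, ?_⟩
    rw [Set.singleton_subset_iff]
    exact ⟨_, self_mem_side u w, _, self_mem_side w u, rfl⟩
  have h2 := (hsub h1).2 rfl
  rw [mem_crossPairs] at h2
  have hd := Set.disjoint_left.1 (Γ.isTree.disjoint_side h')
  by_contra hne
  rcases h2 with ⟨h2, h3⟩ | ⟨h2, h3⟩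
  · exact hd (mem_side_of_adj h2 h hne) h3
  · exact hd h3 (mem_side_of_adj (u := w') (w := u') h2 h (by rwa [Sym2.eq_swap (a := w')]))

/-- A subcomplex of the discrete configuration space that contains the products given by the edges
of the stem. -/
structure IsAmple (Γ : BunchOfGrapes V) (Y : SquareComplex (Sym2 Γ.Vertex)) : Prop where
  subset : Y.cells ⊆ Γ.graph.configCells
  face_mem : ∀ c ∈ Y.cells, ∀ d ∈ Γ.graph.configCells, d ⊆ c → d ∈ Y.cells
  edgeProduct_subset : ∀ u w, Γ.stem.Adj u w → Γ.edgeProduct u w ⊆ Y.cells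

variable {Y : SquareComplex (Sym2 Γ.Vertex)}

theorem IsAmple.isStandardProduct (hY : Γ.IsAmple Y) {A B : Set Γ.Vertex}
    (hA : Γ.graph.IsFactor A) (hB : Γ.graph.IsFactor B) (hAB : Disjoint A B) :
    Y.IsStandardProduct (Γ.graph.fullProduct A B) := by
  obtain ⟨u, w, huw, h1, h2⟩ := exists_edge_of_isFactor hA hB hAB
  exact isStandardProduct_fullProduct hY.subset hY.face_mem hA hB hAB fun c hc =>
    hY.edgeProduct_subset u w huw ⟨hc.1, hc.2.trans (crossPairs_mono h1 h2)⟩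

/-- Every standard product lies in an edge product, and edge products are pairwise incomparable. The
general `Y` is needed because the case of `UD2` is what shows that `UP2` is ample. -/
theorem IsAmple.isMaximalProduct_iff [Finite V] (hmin : Γ.IsMinimal) (hnormal : Γ.IsNormal)
    (hY : Γ.IsAmple Y) {M : Set (Set (Sym2 Γ.Vertex))} :
    Y.IsMaximalProduct M ↔ ∃ u w, Γ.stem.Adj u w ∧ M = Γ.edgeProduct u w := by
  have hstd : ∀ {u w}, Γ.stem.Adj u w → Y.IsStandardProduct (Γ.edgeProduct u w) := fun h =>
    hY.isStandardProduct (isFactor_fiber_side hmin hnormal h)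
      (isFactor_fiber_side hmin hnormal h.symm) (disjoint_fiber (Γ.isTree.disjoint_side h))
  have hle : ∀ {K}, Y.IsStandardProduct K →
      ∃ u w, Γ.stem.Adj u w ∧ K ⊆ Γ.edgeProduct u w := by
    intro K hK
    obtain ⟨A, B, hA, hB, hAB, hsub⟩ := exists_isFactor_of_isStandardProduct hY.subset hK
    obtain ⟨u, w, huw, h1, h2⟩ := exists_edge_of_isFactor hA hB hAB
    exact ⟨u, w, huw, fun c hc => ⟨(hsub hc).1, (hsub hc).2.trans (crossPairs_mono h1 h2)⟩⟩
  constructor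
  · intro hM
    obtain ⟨u, w, huw, hsub⟩ := hle hM.1
    exact ⟨u, w, huw, hM.eq_of_subset (hstd huw) hsub⟩
  · rintro ⟨u, w, huw, rfl⟩
    refine ⟨hstd huw, fun K hK hsub => ?_⟩
    obtain ⟨u', w', huw', hsub'⟩ := hle hK
    rcases Sym2.eq_iff.1 (eq_of_edgeProduct_subset huw huw' (hsub.trans hsub')) with
      ⟨rfl, rfl⟩ | ⟨rfl, rfl⟩
    · exact hsub'
    · rwa [edgeProduct_comm] at hsub'

theorem isAmple_UD2 : Γ.IsAmple Γ.graph.UD2 where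
  subset := subset_rfl
  face_mem _ _ _ hd _ := hd
  edgeProduct_subset _ _ _ _ hc := hc.1

theorem isAmple_UP2 [Finite V] (hmin : Γ.IsMinimal) (hnormal : Γ.IsNormal) :
    Γ.IsAmple Γ.graph.UP2 where
  subset _ := fun ⟨_, hM, hc⟩ => hM.1.subset_cells hc
  face_mem _ := fun ⟨M, hM, hc⟩ _ hd hdc => ⟨M, hM, hM.1.face_mem hc hd hdc⟩
  edgeProduct_subset u w h _ hc :=
    ⟨_, (isAmple_UD2.isMaximalProduct_iff hmin hnormal).2 ⟨u, w, h, rfl⟩, hc⟩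

theorem stem_nontrivial (hnormal : Γ.IsNormal) : Nontrivial V := by
  obtain ⟨⟨v, w, h, -⟩, -⟩ := hnormal
  exact ⟨v, w, h⟩

/-! ### Stems that are paths -/

/-- Each inequality persists along edges other than `uw`, which gives the inclusions. They are
equalities because the two sides cover the stem and the inequalities are complementary. -/
theorem side_of_iso_pathGraph {n : ℕ} (φ : Γ.stem ≃g pathGraph n) {u w : V}
    (h : (φ u).1 + 1 = (φ w).1) :
    Γ.stem.side u w = {x | φ x ≤ φ u} ∧ Γ.stem.side w u = {x | φ u < φ x} := by
  have h1 : Γ.stem.side u w ⊆ {x | φ x ≤ φ u} := by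
    refine side_subset (le_refl (φ u)) fun x y hx hxy hne => ?_
    rw [← φ.map_adj_iff, pathGraph_adj] at hxy
    by_contra hy
    simp only [Set.mem_ofPred_eq, Fin.le_def, not_le] at hx hy
    refine hne (Sym2.eq_iff.2 (Or.inl ⟨φ.injective (Fin.ext ?_), φ.injective (Fin.ext ?_)⟩)) <;>
      omega
  have h2 : Γ.stem.side w u ⊆ {x | φ u < φ x} := by
    refine side_subset (show φ u < φ w from Fin.lt_def.2 (by omega)) fun x y hx hxy hne => ?_
    rw [← φ.map_adj_iff, pathGraph_adj] at hxy
    by_contra hy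
    simp only [Set.mem_ofPred_eq, Fin.lt_def, not_lt] at hx hy
    refine hne (Sym2.eq_iff.2 (Or.inl ⟨φ.injective (Fin.ext ?_), φ.injective (Fin.ext ?_)⟩)) <;>
      omega
  refine ⟨h1.antisymm fun x hx => ?_, h2.antisymm fun x hx => ?_⟩
  · exact (Γ.isTree.mem_side_or u w x).resolve_right fun hx' =>
      absurd (show φ u < φ x from h2 hx') (not_lt_of_ge hx)
  · exact (Γ.isTree.mem_side_or u w x).resolve_left fun hx' =>
      absurd (show φ x ≤ φ u from h1 hx') (not_le_of_gt hx)

theorem intersectionComplexIsSimplex_of_iso_pathGraph [Finite V] (hmin : Γ.IsMinimal)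
    (hnormal : Γ.IsNormal) {n : ℕ} (φ : Γ.stem ≃g pathGraph n) :
    Γ.graph.UP2.IntersectionComplexIsSimplex := by
  have hamp := isAmple_UP2 hmin hnormal
  -- Normality gives two stem vertices, so the path has `k + 1` edges, at least one.
  obtain ⟨k, rfl⟩ : ∃ k, n = k + 1 + 1 := by
    have := stem_nontrivial hnormal
    obtain ⟨v, w, hvw⟩ := exists_pair_ne V
    have := φ.injective.ne hvw
    have := Fin.val_ne_of_ne this
    exact ⟨n - 2, by omega⟩
  let a : Fin (k + 1) → V := fun i => φ.symm i.castSucc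
  let b : Fin (k + 1) → V := fun i => φ.symm i.succ
  have hφa : ∀ i, φ (a i) = i.castSucc := fun i => φ.apply_symm_apply _
  have hφb : ∀ i, φ (b i) = i.succ := fun i => φ.apply_symm_apply _
  have hab : ∀ i, Γ.stem.Adj (a i) (b i) := fun i => by
    rw [← φ.map_adj_iff, hφa, hφb, pathGraph_adj]
    simp
  have hside : ∀ i, Γ.stem.side (a i) (b i) = {x | φ x ≤ i.castSucc} ∧
      Γ.stem.side (b i) (a i) = {x | i.castSucc < φ x} := fun i => by
    have := side_of_iso_pathGraph φ (u := a i) (w := b i) (by simp [hφa, hφb])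
    rwa [hφa] at this
  let f : Fin (k + 1) → Γ.graph.UP2.MaximalProduct := fun i =>
    ⟨Γ.edgeProduct (a i) (b i), (hamp.isMaximalProduct_iff hmin hnormal).2 ⟨_, _, hab i, rfl⟩⟩
  have hf : Function.Bijective f := by
    constructor
    · intro i j hij
      rcases Sym2.eq_iff.1 (eq_of_edgeProduct_subset (hab i) (hab j)
        (congrArg Subtype.val hij).subset) with ⟨h, -⟩ | ⟨h, h'⟩
      · have := congrArg φ h
        rw [hφa, hφa] at this
        exact Fin.castSucc_injective _ this
      · have h1 := congrArg (fun x => (φ x).1) h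
        have h2 := congrArg (fun x => (φ x).1) h'
        simp only [hφa, hφb, Fin.val_succ, Fin.val_castSucc] at h1 h2
        omega
    · rintro ⟨M, hM⟩
      obtain ⟨u, w, huw, rfl⟩ := (hamp.isMaximalProduct_iff hmin hnormal).1 hM
      have key : ∀ {u w : V}, (φ u).1 + 1 = (φ w).1 → ∃ i, a i = u ∧ b i = w := by
        intro u w h
        refine ⟨⟨(φ u).1, by omega⟩, φ.injective ?_, φ.injective ?_⟩
        · rw [hφa]; rfl
        · rw [hφb]; exact Fin.ext h
      rcases pathGraph_adj.1 (φ.map_adj_iff.2 huw) with h | h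
      · obtain ⟨i, rfl, rfl⟩ := key h
        exact ⟨i, rfl⟩
      · obtain ⟨i, rfl, rfl⟩ := key h
        exact ⟨i, Subtype.ext (edgeProduct_comm (a i) (b i))⟩
  refine SquareComplex.intersectionComplexIsSimplex_of_equiv (Equiv.ofBijective f hf).symm ?_
  intro S hS
  obtain ⟨i, hi, hmini⟩ : ∃ i, f i ∈ S ∧ ∀ j, f j ∈ S → i ≤ j := by
    obtain ⟨M, hM⟩ := hS
    obtain ⟨i, rfl⟩ := hf.2 M
    obtain ⟨j, hj, hj'⟩ := Set.exists_min_image {i | f i ∈ S} id (Set.toFinite _) ⟨i, hM⟩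
    exact ⟨j, hj, hj'⟩
  obtain ⟨j, hj, hmaxj⟩ : ∃ j, f j ∈ S ∧ ∀ l, f l ∈ S → l ≤ j := by
    obtain ⟨M, hM⟩ := hS
    obtain ⟨i, rfl⟩ := hf.2 M
    obtain ⟨j, hj, hj'⟩ := Set.exists_max_image {i | f i ∈ S} id (Set.toFinite _) ⟨i, hM⟩
    exact ⟨j, hj, hj'⟩
  have hij := hmini j hj
  -- Only the extreme edges `i ≤ j` matter: if both separate `x` from `y`, they do so in the same
  -- order, with one point before `i` and the other after `j`, and then every edge in between
  -- separates them too.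
  have heq : {c | ∀ M ∈ S, c ∈ M.1} = Γ.graph.fullProduct (Γ.fiber (Γ.stem.side (a i) (b i)))
      (Γ.fiber (Γ.stem.side (b j) (a j))) := by
    ext c
    constructor
    · intro hc
      refine ⟨(hc _ hi).1, fun p hp => ?_⟩
      have h1 := (hc _ hi).2 hp
      have h2 := (hc _ hj).2 hp
      induction p with
      | _ x y =>
        rw [mem_crossPairs] at h1 h2 ⊢
        simp only [fiber, hside, Set.mem_preimage, Set.mem_ofPred_eq, Fin.le_def, Fin.lt_def,
          Fin.val_castSucc] at h1 h2 ⊢ hij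
        omega
    · rintro ⟨hc, hsub⟩ M hM
      obtain ⟨l, rfl⟩ := hf.2 M
      have h1 := hmini l hM
      have h2 := hmaxj l hM
      refine ⟨hc, hsub.trans (crossPairs_mono (fiber_mono ?_) (fiber_mono ?_))⟩
      · rw [(hside i).1, (hside l).1]
        exact fun x hx => le_trans (show φ x ≤ i.castSucc from hx)
          (show i.castSucc ≤ l.castSucc from h1)
      · rw [(hside j).2, (hside l).2]
        exact fun x hx => lt_of_le_of_lt (show l.castSucc ≤ j.castSucc from h2) hx
  rw [heq]
  refine hamp.isStandardProduct (isFactor_fiber_side hmin hnormal (hab i))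
    (isFactor_fiber_side hmin hnormal (hab j).symm) (disjoint_fiber ?_)
  rw [(hside i).1, (hside j).2, Set.disjoint_left]
  exact fun x hx hx' => absurd (le_trans hx (show i.castSucc ≤ j.castSucc from hij))
    (not_le_of_gt hx')

/-! ### Stems that are not paths -/

/-- Two vertices on the same side of the edge `vn` are not separated by the edges that touch the
other side. -/
theorem mem_side_or_mem_side_of_crossPairs {n v u w : V} (hnv : Γ.stem.Adj n v)
    (huw : Γ.stem.Adj u w) (hu : u ∈ Γ.stem.side n v) {x y : Γ.Vertex}
    (h : s(x, y) ∈ crossPairs (Γ.fiber (Γ.stem.side u w)) (Γ.fiber (Γ.stem.side w u))) :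
    base x ∈ Γ.stem.side n v ∨ base y ∈ Γ.stem.side n v := by
  by_contra! hxy
  have hx := (Γ.isTree.mem_side_or n v (base x)).resolve_left hxy.1
  have hy := (Γ.isTree.mem_side_or n v (base y)).resolve_left hxy.2
  have hu' := Set.disjoint_left.1 (Γ.isTree.disjoint_side hnv) hu
  have hd := Set.disjoint_left.1 (Γ.isTree.disjoint_side huw)
  rw [mem_crossPairs] at h
  -- On whichever side of `uw` the vertex `v` lies, its whole side of the edge `vn` lies there too,
  -- so `uw` cannot separate `x` from `y`.
  rcases Γ.isTree.mem_side_or u w v with hv | hv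
  · have hsub := side_subset_side (Or.inl hu') hv
    rcases h with ⟨-, h⟩ | ⟨h, -⟩
    · exact hd (hsub hy) h
    · exact hd (hsub hx) h
  · have hsub := side_subset_side (Or.inr hu') hv
    rcases h with ⟨h, -⟩ | ⟨-, h⟩
    · exact hd h (hsub hx)
    · exact hd h (hsub hy)

theorem not_simplyConnectedSpace_of_claw [Finite V] (hmin : Γ.IsMinimal) (hnormal : Γ.IsNormal)
    {v : V} {n : Fin 3 → V} (hn : Function.Injective n) (hv : ∀ k, Γ.stem.Adj v (n k)) :
    ¬ SimplyConnectedSpace Γ.graph.UP2.IntersectionComplex := by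
  classical
  have hamp := isAmple_UP2 hmin hnormal
  have hiff := fun {M} => hamp.isMaximalProduct_iff hmin hnormal (M := M)
  -- the branches of the stem at `v`
  let br : Fin 3 → Set V := fun k => Γ.stem.side (n k) v
  have hbr : ∀ k, n k ∈ br k := fun k => self_mem_side _ _
  have hvbr : ∀ k, v ∉ br k := fun k h =>
    Set.disjoint_left.1 (Γ.isTree.disjoint_side (hv k).symm) h (self_mem_side _ _)
  have hnbr : ∀ {i j}, i ≠ j → n j ∈ Γ.stem.side v (n i) := fun {i j} hij =>
    mem_side_of_adj (self_mem_side _ _) (hv j) fun he => by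
      rcases Sym2.eq_iff.1 he with ⟨-, h⟩ | ⟨h, -⟩
      · exact hij (hn h).symm
      · exact (hv i).ne h
  have hbrsub : ∀ {i j}, i ≠ j → br j ⊆ Γ.stem.side v (n i) := fun {i j} hij =>
    side_subset_side (Or.inl (hvbr j)) (hnbr hij)
  have hdisj : ∀ {i j}, i ≠ j → Disjoint (br i) (br j) := fun {i j} hij =>
    (Γ.isTree.disjoint_side (hv i).symm).mono_right (hbrsub hij)
  -- the colour of an edge: the branch which it touches
  let touches : Γ.graph.UP2.MaximalProduct → Fin 3 → Prop := fun M k =>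
    ∃ u w, Γ.stem.Adj u w ∧ M.1 = Γ.edgeProduct u w ∧ u ∈ br k
  -- Colour 2 is the default, so it also takes the edges in any further branches at `v`.
  let color : Γ.graph.UP2.MaximalProduct → Fin 3 := fun M =>
    if touches M 0 then 0 else if touches M 1 then 1 else 2
  let M : Fin 3 → Γ.graph.UP2.MaximalProduct := fun k =>
    ⟨Γ.edgeProduct (n k) v, hiff.2 ⟨_, _, (hv k).symm, rfl⟩⟩
  have hself : ∀ k, touches (M k) k := fun k => ⟨_, _, (hv k).symm, rfl, hbr k⟩
  have hother : ∀ {i j}, i ≠ j → ¬ touches (M j) i := by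
    rintro i j hij ⟨u, w, huw, he, hu⟩
    rcases Sym2.eq_iff.1 (eq_of_edgeProduct_subset (hv j).symm huw he.subset) with
      ⟨rfl, -⟩ | ⟨-, rfl⟩
    · exact Set.disjoint_left.1 (hdisj hij) hu (hbr j)
    · exact hvbr i hu
  refine SquareComplex.not_simplyConnectedSpace_of_coloring color ?_ M ?_ ?_
  · intro σ
    by_contra! hall
    obtain ⟨L0, hL0, hc0⟩ := hall 0
    obtain ⟨L1, hL1, hc1⟩ := hall 1
    obtain ⟨L2, hL2, hc2⟩ := hall 2
    have ht0 : touches L0 0 := by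
      by_contra h
      simp only [color, h, if_false] at hc0
      split_ifs at hc0 <;> simp at hc0
    have ht1 : touches L1 1 := by
      by_contra h
      simp only [color, h, if_false] at hc1
      split_ifs at hc1 <;> simp at hc1
    have ht2 : ¬ touches L2 0 ∧ ¬ touches L2 1 := by
      simp only [color] at hc2
      split_ifs at hc2 with h h'
      · simp at hc2
      · simp at hc2
      · exact ⟨h, h'⟩
    -- The label of a simplex is a nonempty product, so some configuration `{x, y}` lies in all the
    -- maximal products of the simplex.
    obtain ⟨x, y, hxy⟩ : ∃ x y : Γ.Vertex, ∀ L ∈ σ.verts, ∃ c ∈ L.1, s(x, y) ∈ c := by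
      obtain ⟨A, B, H, H', f, hf, hK⟩ := σ.isMaximal.1.1
      obtain ⟨a⟩ := hf.1.nonempty
      obtain ⟨b⟩ := hf.2.1.nonempty
      have hmem : f '' {(a, b)} ∈ σ.label := by
        rw [hK]
        exact ⟨_, ⟨{a}, Or.inl ⟨a, rfl⟩, {b}, Or.inl ⟨b, rfl⟩, by simp⟩, rfl⟩
      generalize hp : f (a, b) = p
      induction p with
      | _ x y => exact ⟨x, y, fun L hL => ⟨_, σ.isMaximal.1.2 L hL hmem, by simp [hp]⟩⟩
    have hsep : ∀ {L u w}, L ∈ σ.verts → L.1 = Γ.edgeProduct u w →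
        s(x, y) ∈ crossPairs (Γ.fiber (Γ.stem.side u w)) (Γ.fiber (Γ.stem.side w u)) := by
      intro L u w hL he
      obtain ⟨c, hc, hxc⟩ := hxy L hL
      rw [he] at hc
      exact hc.2 hxc
    have hin : ∀ {L k}, L ∈ σ.verts → touches L k → base x ∈ br k ∨ base y ∈ br k := by
      rintro L k hL ⟨u, w, huw, he, hu⟩
      exact mem_side_or_mem_side_of_crossPairs (hv k).symm huw hu (hsep hL he)
    have h0 := hin hL0 ht0
    have h1 := hin hL1 ht1
    have h01 := Set.disjoint_left.1 (hdisj (show (0 : Fin 3) ≠ 1 by decide))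
    obtain ⟨u, w, huw, he⟩ := hiff.1 L2.2
    have hu : ∀ k, k ≠ 2 → u ∉ br k := fun k hk hu => by
      have : touches L2 k := ⟨u, w, huw, he, hu⟩
      fin_cases k <;> simp_all
    have hw : ∀ k, k ≠ 2 → w ∉ br k := fun k hk hw => by
      have : touches L2 k := ⟨w, u, huw.symm, he.trans (edgeProduct_comm _ _), hw⟩
      fin_cases k <;> simp_all
    have hd := Set.disjoint_left.1 (Γ.isTree.disjoint_side huw)
    have hin2 : ∃ i j : Fin 3, i ≠ 2 ∧ j ≠ 2 ∧ base x ∈ br i ∧ base y ∈ br j := by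
      rcases h0 with h0 | h0 <;> rcases h1 with h1 | h1
      · exact absurd h1 (h01 h0)
      · exact ⟨0, 1, by decide, by decide, h0, h1⟩
      · exact ⟨1, 0, by decide, by decide, h1, h0⟩
      · exact absurd h1 (h01 h0)
    obtain ⟨i, j, hi, hj, hxi, hyj⟩ := hin2
    -- The edge of `L2` touches neither branch 0 nor branch 1, so both branches lie on the same side
    -- of it as `v`, and it fails to separate `x` from `y`.
    have hsub : ∀ {p q k}, v ∈ Γ.stem.side p q → p ∉ br k → q ∉ br k → s(p, q) = s(u, w) →
        br k ⊆ Γ.stem.side p q := by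
      intro p q k hp hpk hqk hpq
      refine side_subset_side (Or.inl hpk) (mem_side_of_adj hp (hv k) fun h => ?_)
      rcases Sym2.eq_iff.1 h with ⟨-, h⟩ | ⟨-, h⟩
      · exact hqk (h ▸ hbr k)
      · exact hpk (h ▸ hbr k)
    have hs := mem_crossPairs.1 (hsep hL2 he)
    rcases Γ.isTree.mem_side_or u w v with hvu | hvw
    · have hx := hsub hvu (hu i hi) (hw i hi) rfl hxi
      have hy := hsub hvu (hu j hj) (hw j hj) rfl hyj
      rcases hs with ⟨-, h⟩ | ⟨h, -⟩
      · exact hd hy h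
      · exact hd hx h
    · have hx := hsub hvw (hw i hi) (hu i hi) Sym2.eq_swap hxi
      have hy := hsub hvw (hw j hj) (hu j hj) Sym2.eq_swap hyj
      rcases hs with ⟨h, -⟩ | ⟨-, h⟩
      · exact hd h hx
      · exact hd h hy
  · intro k
    have h01 := hother (show (0 : Fin 3) ≠ 1 by decide)
    have h02 := hother (show (0 : Fin 3) ≠ 2 by decide)
    have h12 := hother (show (1 : Fin 3) ≠ 2 by decide)
    have h0 := hself 0
    have h1 := hself 1
    fin_cases k
    · exact if_pos h0
    · exact (if_neg h01).trans (if_pos h1)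
    · exact (if_neg h02).trans (if_neg h12)
  · intro i j
    by_cases hij : i = j
    · subst hij
      exact ⟨(M i).simplex, by simp [SquareComplex.MaximalProduct.simplex]⟩
    have hstd : Γ.graph.UP2.IsStandardProduct (Γ.graph.fullProduct (Γ.fiber (br i))
        (Γ.fiber (br j))) :=
      hamp.isStandardProduct (isFactor_fiber_side hmin hnormal (hv i).symm)
        (isFactor_fiber_side hmin hnormal (hv j).symm) (disjoint_fiber (hdisj hij))
    have hsub : ∀ L ∈ ({M i, M j} : Finset _), Γ.graph.fullProduct (Γ.fiber (br i))
        (Γ.fiber (br j)) ⊆ L.1 := by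
      intro L hL
      rcases Finset.mem_insert.1 hL with rfl | hL
      · exact fun c hc => ⟨hc.1, hc.2.trans (crossPairs_mono subset_rfl
          (fiber_mono (hbrsub hij)))⟩
      · rw [Finset.mem_singleton.1 hL]
        refine fun c hc => ⟨hc.1, hc.2.trans ?_⟩
        rw [crossPairs_comm]
        exact crossPairs_mono subset_rfl (fiber_mono (hbrsub (Ne.symm hij)))
    -- The product of the two branches need not be shown maximal in the intersection: finiteness
    -- provides a maximal label containing it.
    obtain ⟨K, -, hK⟩ := Finite.exists_le_maximal
      (p := fun K => Γ.graph.UP2.IsStandardProduct K ∧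
        ∀ L ∈ ({M i, M j} : Finset Γ.graph.UP2.MaximalProduct), K ⊆ L.1) ⟨hstd, hsub⟩
    exact ⟨⟨{M i, M j}, K, by simp, hK⟩, by simp, by simp⟩

end BunchOfGrapes

theorem mainTheorem12 {V : Type u} [Finite V] (Γ : BunchOfGrapes V)
    (hmin : Γ.IsMinimal) (hnormal : Γ.IsNormal) :
    List.TFAE [
      ∃ n : ℕ, Nonempty (Γ.stem ≃g SimpleGraph.pathGraph n),
      Γ.graph.UP2.IntersectionComplexIsSimplex,
      SimplyConnectedSpace Γ.graph.UP2.IntersectionComplex] := by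
  tfae_have 1 → 2 := fun ⟨_, ⟨φ⟩⟩ =>
    BunchOfGrapes.intersectionComplexIsSimplex_of_iso_pathGraph hmin hnormal φ
  tfae_have 2 → 3 := fun h => h.simplyConnectedSpace
  tfae_have 3 → 1 := fun h => Γ.isTree.exists_iso_pathGraph fun ⟨_, _, hn, hv⟩ =>
    BunchOfGrapes.not_simplyConnectedSpace_of_claw hmin hnormal hn hv h
  tfae_finish
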